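/- Let $K$ be a field equipped with the trivial absolute value, let $X$ be an integral projective scheme over $\operatorname{Spec} K$ with Berkovich analytification $X^{\mathrm{an}}$, and let $f : X \to X$ be a surjective endomorphism over $K$. Write $\operatorname{Rat}(X)^\times_{\mathbb R} = \operatorname{Rat}(X)^\times \otimes_{\mathbb Z} \mathbb R$ and $\operatorname{Div}_{\mathbb R}(X) = \operatorname{Div}(X) \otimes_{\mathbb Z} \mathbb R$, where $\operatorname{Div}(X)$ is the group of Cartier divisors. Let $D \in \operatorname{Div}_{\mathbb R}(X)$ be such that $f^*(D) = dD + (\varphi)$ for some real $d > 1$ and some $\varphi \in \operatorname{Rat}(X)^\times_{\mathbb R}$. A Green function of $D$ is a continuous real function $g$ on $U_0^{\mathrm{an}}$ for some non-empty Zariski open $U_0 \subseteq X$ (two such functions being identified if they agree on $U_1^{\mathrm{an}}$ for some non-empty open $U_1$) such that, for every local equation $\psi \in \operatorname{Rat}(X)^\times_{\mathbb R}$ of $D$ on a non-empty open $U$, $g + \log|\psi|$ extends to a continuous function on $U^{\mathrm{an}}$. For $\xi \in X^{\mathrm{an}}$, with absolute value $|\cdot|_\xi$ on the residue field $\kappa(\xi)$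 of the underlying scheme point, the reduction point $r_\xi \in X$ is the image of the closed point under the unique extension $\operatorname{Spec}\{\alpha \in \kappa(\xi) : |\alpha|_\xi \leqslant 1\} \to X$ of $\operatorname{Spec}\kappa(\xi) \to X$, and the height $h^{\mathrm{an}}_{(D,g)}(\xi)$ is the value at $\xi$ of the continuous extension of $g + \log|\psi|$ to $U^{\mathrm{an}}$, where $\psi$ is a local equation of $D$ on an open neighbourhood $U$ of $r_\xi$ (it does not depend on the choices). The pair $(D,g)$ is effective if $D$ is a combination of effective Cartier divisors with positive real coefficients and $g$, viewed as the function $-\log(\mathrm e^{-g}) : X^{\mathrm{an}} \to \mathbb R \cup \{+\infty\}$ via the continuous extension of $\mathrm e^{-g}$ to $X^{\mathrm{an}}$, is non-negative. An $\mathbb R$-Cartier divisor is semiample if it is a combination with non-negative real coefficients of Cartier divisors $A$ such that $\mathcal O_X(nA)$ is globally generated for some $n \geqslant 1$. Let $\eta_0 \in X^{\mathrm{an}}$ be the generic point of $X$ with the trivial absolute value. Let $g$ be the canonical Green function of $D$ with respect to $f$, i.e. the Green function of $D$ with $(f^{\mathrm{an}})^*(g) = d g - \log|\varphi|$. Then: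 1. $h^{\mathrm{an}}_{(D,g)}(f^{\mathrm{an}}(\xi)) = d\, h^{\mathrm{an}}_{(D,g)}(\xi)$ for all $\xi \in X^{\mathrm{an}}$. 2. If $\xi \in X^{\mathrm{an}}$ satisfies $(f^{\mathrm{an}})^n(\xi) = (f^{\mathrm{an}})^m(\xi)$ for some integers $0 \leqslant n < m$, then $h^{\mathrm{an}}_{(D,g)}(\xi) = 0$. 3. $h^{\mathrm{an}}_{(D,g)}(\eta_0) = 0$, and $g(\eta_0) = 0$. 4. If $D$ is semiample, then $h^{\mathrm{an}}_{(D,g)}(\xi) \geqslant 0$ for all $\xi \in X^{\mathrm{an}}$. 5. If $D + (s)$ is effective for some $s \in \operatorname{Rat}(X)^\times_{\mathbb R}$, then for every $\varepsilon > 0$ there is $\psi_\varepsilon \in \operatorname{Rat}(X)^\times_{\mathbb R}$ such that $(D + (\psi_\varepsilon),\ g + \varepsilon - \log|\psi_\varepsilon|)$ is effective. -/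

import Mathlib

open CategoryTheory AlgebraicGeometry TensorProduct Topology

universe u

namespace TrivArakelov

noncomputable section

/-! ### Projective schemes over a field -/

section Projective

attribute [local instance] MvPolynomial.gradedAlgebra

/-- The structure morphism of projective `n`-space `Proj K[T₀, …, Tₙ]` over `K`. -/
def projStructure (K : Type u) [Field K] (n : ℕ) :
    Proj (MvPolynomial.homogeneousSubmodule (Fin (n + 1)) K) ⟶ Spec (.of K) :=
  Proj.toSpecZero (MvPolynomial.homogeneousSubmodule (Fin (n + 1)) K) ≫
    Spec.map (CommRingCat.ofHom
      (algebraMap K (MvPolynomial.homogeneousSubmodule (Fin (n + 1)) K 0)))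

/-- `π : X ⟶ Spec K` is projective: `X` is a closed subscheme of some `ℙⁿ` over `K`. -/
class IsProjectiveOver {K : Type u} [Field K] {X : Scheme.{u}} (π : X ⟶ Spec (.of K)) :
    Prop where
  exists_closedImmersion : ∃ (n : ℕ)
    (i : X ⟶ Proj (MvPolynomial.homogeneousSubmodule (Fin (n + 1)) K)),
      IsClosedImmersion i ∧ i ≫ projStructure K n = π

theorem bijective_algebraMap_zero (K : Type u) [Field K] (n : ℕ) :
    Function.Bijective
      (algebraMap K (MvPolynomial.homogeneousSubmodule (Fin (n + 1)) K 0)) := by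
  refine ⟨fun a b h => MvPolynomial.C_injective (Fin (n + 1)) K (congrArg Subtype.val h),
    fun ⟨p, hp⟩ => ?_⟩
  have hp' : p.IsHomogeneous 0 := hp
  refine ⟨p.coeff 0, Subtype.ext ?_⟩
  exact (MvPolynomial.totalDegree_eq_zero_iff_eq_C.mp
    (Nat.le_zero.mp hp'.totalDegree_le)).symm

instance isProper_projStructure (K : Type u) [Field K] (n : ℕ) :
    IsProper (projStructure K n) := by
  have h0 : IsIso (CommRingCat.ofHom
      (algebraMap K (MvPolynomial.homogeneousSubmodule (Fin (n + 1)) K 0))) :=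
    (ConcreteCategory.isIso_iff_bijective _).mpr (bijective_algebraMap_zero K n)
  have h1 : Algebra.FiniteType (MvPolynomial.homogeneousSubmodule (Fin (n + 1)) K 0)
      (MvPolynomial (Fin (n + 1)) K) :=
    have : IsScalarTower K (MvPolynomial.homogeneousSubmodule (Fin (n + 1)) K 0)
        (MvPolynomial (Fin (n + 1)) K) := ⟨fun a b c => by
      change (a • (b : MvPolynomial (Fin (n + 1)) K)) * c = a • ((b : MvPolynomial (Fin (n + 1)) K) * c)
      exact smul_mul_assoc _ _ _⟩
    Algebra.FiniteType.of_restrictScalars_finiteType K _ _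
  unfold projStructure
  infer_instance

instance isProper_of_isProjectiveOver {K : Type u} [Field K] {X : Scheme.{u}}
    (π : X ⟶ Spec (.of K)) [h : IsProjectiveOver π] : IsProper π := by
  obtain ⟨n, i, hi, rfl⟩ := h.exists_closedImmersion
  infer_instance

end Projective

/-! ### `ℝ`-rational functions and `ℝ`-Cartier divisors -/

section Divisors

variable (X : Scheme.{u}) [IsIntegral X]

/-- The subgroup `𝒪_{X,x}ˣ` of `Rat(X)ˣ`. -/
def stalkUnits (x : X) : Subgroup (X.functionField)ˣ :=
  (Units.map (algebraMap (X.presheaf.stalk x) X.functionField).toMonoidHom).range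

/-- The stalk `Rat(X)ˣ / 𝒪_{X,x}ˣ` at `x` of the sheaf `ℳ_Xˣ / 𝒪_Xˣ`. -/
def LocalDiv (x : X) : Type u := (X.functionField)ˣ ⧸ stalkUnits X x

instance (x : X) : CommGroup (LocalDiv X x) :=
  QuotientGroup.Quotient.commGroup (stalkUnits X x)

/-- The germ at `x` of the principal divisor of a rational function. -/
def localDiv (x : X) : (X.functionField)ˣ →* LocalDiv X x := QuotientGroup.mk' (stalkUnits X x)

/-- Global sections of `ℳ_Xˣ / 𝒪_Xˣ`. As `X` is integral, `ℳ_X` is the constant sheaf `Rat(X)`, and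
a section of the quotient sheaf is a family of germs that is locally induced by one rational
function. -/
def divSubgroup : Subgroup (∀ x : X, LocalDiv X x) where
  carrier := {D | ∀ x : X, ∃ U : X.Opens, x ∈ U ∧ ∃ φ : (X.functionField)ˣ,
    ∀ y ∈ U, D y = localDiv X y φ}
  mul_mem' := by
    intro D E hD hE x
    obtain ⟨U, hxU, φ, hφ⟩ := hD x
    obtain ⟨V, hxV, ψ, hψ⟩ := hE x
    refine ⟨U ⊓ V, ⟨hxU, hxV⟩, φ * ψ, fun y hy => ?_⟩
    rw [Pi.mul_apply, hφ y hy.1, hψ y hy.2, map_mul]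
  one_mem' := fun x => ⟨⊤, trivial, 1, fun y _ => (map_one _).symm⟩
  inv_mem' := by
    intro D hD x
    obtain ⟨U, hxU, φ, hφ⟩ := hD x
    refine ⟨U, hxU, φ⁻¹, fun y hy => ?_⟩
    rw [Pi.inv_apply, hφ y hy, map_inv]

/-- The group of Cartier divisors `Div(X) = H⁰(X, ℳ_Xˣ / 𝒪_Xˣ)`, written multiplicatively. -/
def Div : Type u := divSubgroup X

instance : CommGroup (Div X) := inferInstanceAs (CommGroup (divSubgroup X))

/-- The germ of a Cartier divisor at a point. -/
def germ (x : X) : Div X →* LocalDiv X x :=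
  (Pi.evalMonoidHom (fun x : X => LocalDiv X x) x).comp (divSubgroup X).subtype

/-- The principal Cartier divisor `(φ)` of a non-zero rational function. -/
def principal : (X.functionField)ˣ →* Div X where
  toFun φ := ⟨fun x => localDiv X x φ, fun _ => ⟨⊤, trivial, φ, fun _ _ => rfl⟩⟩
  map_one' := Subtype.ext <| funext fun x => map_one (localDiv X x)
  map_mul' φ ψ := Subtype.ext <| funext fun x => map_mul (localDiv X x) φ ψ

/-- `ℝ`-rational functions `Rat(X)ˣ ⊗ ℝ`, written additively. -/
abbrev RatR : Type u := ℝ ⊗[ℤ] Additive (X.functionField)ˣ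

/-- `ℝ`-Cartier divisors `Div(X) ⊗ ℝ`. -/
abbrev DivR : Type u := ℝ ⊗[ℤ] Additive (Div X)

/-- The scalar extension `G ⊗ ℝ → H ⊗ ℝ` of a homomorphism of abelian groups. -/
def mapR {G H : Type u} [CommGroup G] [CommGroup H] (φ : G →* H) :
    ℝ ⊗[ℤ] Additive G →ₗ[ℝ] ℝ ⊗[ℤ] Additive H :=
  (MonoidHom.toAdditive φ).toIntLinearMap.baseChange ℝ

/-- The `ℝ`-principal divisor `(φ)` of an `ℝ`-rational function. -/
def principalR : RatR X →ₗ[ℝ] DivR X := mapR (principal X)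

variable {X}

/-- The image in `Div_ℝ(X)` of a Cartier divisor. -/
def Div.toR (E : Div X) : DivR X := 1 ⊗ₜ[ℤ] Additive.ofMul E

/-- `φ` is a local equation of `D` on `U`: the two have the same germ in
`(Rat(X)ˣ / 𝒪_{X,x}ˣ) ⊗ ℝ` at every `x ∈ U`. (For quasi-compact `U` this says that `D` and `(φ)`
have the same restriction in `Div(U) ⊗ ℝ`: a Cartier divisor that is torsion at a point is torsion
near that point.) -/
def IsLocalEquation (D : DivR X) (φ : RatR X) (U : X.Opens) : Prop :=
  ∀ x ∈ U, mapR (germ X x) D = mapR (localDiv X x) φ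

/-- A Cartier divisor is effective if its local equations are regular functions. -/
def Div.IsEffective (E : Div X) : Prop :=
  ∀ x : X, ∀ φ : (X.functionField)ˣ, germ X x E = localDiv X x φ →
    (φ : X.functionField) ∈ (algebraMap (X.presheaf.stalk x) X.functionField).range

/-- An `ℝ`-Cartier divisor is (`ℝ`-)effective if it is a combination of effective Cartier divisors
with positive coefficients. -/
def IsEffective (D : DivR X) : Prop :=
  ∃ (r : ℕ) (E : Fin r → Div X) (a : Fin r → ℝ),
    (∀ i, (E i).IsEffective) ∧ (∀ i, 0 < a i) ∧ D = ∑ i, a i • (E i).toR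

/-- The stalk at `x` of the sheaf `𝒪_X(E) ⊆ ℳ_X`: it is `f⁻¹ 𝒪_{X,x}` for any local equation `f`
of `E` at `x`. -/
def Div.sheafStalk (E : Div X) (x : X) : Set X.functionField :=
  {s | ∀ φ : (X.functionField)ˣ, germ X x E = localDiv X x φ →
    s * φ ∈ (algebraMap (X.presheaf.stalk x) X.functionField).range}

/-- The global sections `H⁰(X, 𝒪_X(E))`, as rational functions. -/
def Div.globalSections (E : Div X) : Set X.functionField :=
  {s | ∀ x : X, s ∈ E.sheafStalk x}

/-- `𝒪_X(E)` is generated by global sections. -/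
def Div.IsGloballyGenerated (E : Div X) : Prop :=
  ∀ x : X, E.sheafStalk x ⊆
    (Submodule.span (X.presheaf.stalk x) E.globalSections : Set X.functionField)

/-- A Cartier divisor `E` is semiample if `𝒪_X(nE)` is globally generated for some `n ≥ 1`. -/
def Div.IsSemiample (E : Div X) : Prop :=
  ∃ n : ℕ, 0 < n ∧ (E ^ n).IsGloballyGenerated

/-- An `ℝ`-Cartier divisor is semiample if it is a combination of semiample Cartier divisors
with non-negative coefficients. -/
def IsSemiample (D : DivR X) : Prop :=
  ∃ (r : ℕ) (A : Fin r → Div X) (a : Fin r → ℝ),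
    (∀ i, (A i).IsSemiample) ∧ (∀ i, 0 ≤ a i) ∧ D = ∑ i, a i • (A i).toR

end Divisors

/-! ### Pullback by a dominant morphism -/

section Pullback

variable {X Y : Scheme.{u}} [IsIntegral X] [IsIntegral Y] (f : X ⟶ Y) [IsDominant f]

theorem map_genericPoint : f (genericPoint X) = genericPoint Y := by
  refine IsGenericPoint.eq ?_ (genericPoint_spec Y)
  have h := (genericPoint_spec X).image f.continuous
  rwa [Set.image_univ, f.denseRange.closure_range] at h

/-- The field homomorphism `f^* : Rat(Y) → Rat(X)`, the map on stalks at the generic points. -/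
def pullbackRat : Y.functionField →+* X.functionField :=
  (Y.presheaf.stalkSpecializes (specializes_of_eq (map_genericPoint f)) ≫
    f.stalkMap (genericPoint X)).hom

theorem pullbackRat_algebraMap (x : X) (s : Y.presheaf.stalk (f x)) :
    pullbackRat f (algebraMap (Y.presheaf.stalk (f x)) Y.functionField s) =
      algebraMap (X.presheaf.stalk x) X.functionField (f.stalkMap x s) := by
  have h : (Y.presheaf.stalkSpecializes (genericPoint_specializes (f x)) ≫
      Y.presheaf.stalkSpecializes (specializes_of_eq (map_genericPoint f))) ≫
        f.stalkMap (genericPoint X) =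
      f.stalkMap x ≫ X.presheaf.stalkSpecializes (genericPoint_specializes x) := by
    rw [TopCat.Presheaf.stalkSpecializes_comp]
    exact Scheme.Hom.stalkSpecializes_stalkMap f _ _ (genericPoint_specializes x)
  exact congr($(h).hom s)

theorem pullbackRat_mem_stalkUnits (x : X) :
    stalkUnits Y (f x) ≤
      (stalkUnits X x).comap (Units.map (pullbackRat f).toMonoidHom) := by
  rintro _ ⟨s, rfl⟩
  refine ⟨Units.map (f.stalkMap x).hom.toMonoidHom s, Units.ext ?_⟩
  exact (pullbackRat_algebraMap f x s).symm

/-- The map `Rat(Y)ˣ / 𝒪_{Y,f(x)}ˣ → Rat(X)ˣ / 𝒪_{X,x}ˣ` induced by `f^*`. -/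
def pullbackLocalDiv (x : X) : LocalDiv Y (f x) →* LocalDiv X x :=
  QuotientGroup.map (stalkUnits Y (f x)) (stalkUnits X x) (Units.map (pullbackRat f).toMonoidHom)
    (pullbackRat_mem_stalkUnits f x)

/-- The pullback `f^* : Div(Y) → Div(X)`: if `φ` is a local equation of `D` at `f x`, then `f^* φ`
is a local equation of `f^* D` at `x`. -/
def pullbackDiv : Div Y →* Div X where
  toFun D := ⟨fun x => pullbackLocalDiv f x (germ Y (f x) D), fun x => by
    obtain ⟨U, hxU, φ, hφ⟩ := D.2 (f x)
    refine ⟨f ⁻¹ᵁ U, hxU, Units.map (pullbackRat f).toMonoidHom φ, fun y hy => ?_⟩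
    have h : germ Y (f y) D = localDiv Y (f y) φ := hφ (f y) hy
    change pullbackLocalDiv f y (germ Y (f y) D) = _
    rw [h]
    rfl⟩
  map_one' := Subtype.ext <| funext fun x => by
    change pullbackLocalDiv f x (germ Y (f x) 1) = 1
    rw [map_one, map_one]
  map_mul' D E := Subtype.ext <| funext fun x => by
    change pullbackLocalDiv f x (germ Y (f x) (D * E)) =
      pullbackLocalDiv f x (germ Y (f x) D) * pullbackLocalDiv f x (germ Y (f x) E)
    rw [map_mul, map_mul]

/-- The pullback `f^* : Div_ℝ(Y) → Div_ℝ(X)`. -/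
def pullbackDivR : DivR Y →ₗ[ℝ] DivR X := mapR (pullbackDiv f)

end Pullback

/-! ### Berkovich spaces over a trivially valued field -/

section Berkovich

variable {K : Type u} [Field K] {X Y : Scheme.{u}}

/-- The structure homomorphism `K → κ(x)` of the residue field at `x`. -/
def constMap (π : X ⟶ Spec (.of K)) (x : X) : K →+* X.residueField x :=
  ((Scheme.ΓSpecIso (.of K)).inv ≫ π.appTop ≫ X.evaluation ⊤ x trivial).hom

/-- A point of the Berkovich analytification `X^an` of a scheme `X` over the trivially valued field
`K`: a point of `X` with an absolute value on its residue field that is trivial on `K`. -/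
@[ext]
structure An (π : X ⟶ Spec (.of K)) where
  /-- The underlying scheme point. -/
  pt : X
  /-- The absolute value on the residue field. -/
  abv : AbsoluteValue (X.residueField pt) ℝ
  abv_const : ∀ a : K, a ≠ 0 → abv (constMap π pt a) = 1

variable {π : X ⟶ Spec (.of K)}

/-- The subset `U^an` of `X^an`. -/
def anSet (π : X ⟶ Spec (.of K)) (U : X.Opens) : Set (An π) := {ξ | ξ.pt ∈ U}

/-- The Berkovich topology: the coarsest one for which `X^an → X` is continuous and, for all regular
functions `s` on open subsets `U` of `X`, the function `|s|` on `U^an` is continuous. -/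
instance : TopologicalSpace (An π) :=
  TopologicalSpace.generateFrom
    ({S | ∃ U : X.Opens, S = anSet π U} ∪
      {S | ∃ (U : X.Opens) (s : Γ(X, U)) (V : Set ℝ), IsOpen V ∧
        S = {ξ | ∃ h : ξ.pt ∈ U, ξ.abv (X.evaluation U ξ.pt h s) ∈ V}})

/-- The point `x^an` of `X^an` given by a scheme point and the trivial absolute value. -/
def trivialPoint (π : X ⟶ Spec (.of K)) (x : X) : An π where
  pt := x
  abv := open Classical in AbsoluteValue.trivial
  abv_const a ha := by
    classical
    exact AbsoluteValue.trivial_apply ((map_ne_zero (constMap π x)).mpr ha)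

/-- The point `η₀`: the generic point of `X` with the trivial absolute value. -/
def genericAn (π : X ⟶ Spec (.of K)) [IsIntegral X] : An π := trivialPoint π (genericPoint X)

theorem residueFieldMap_constMap (f : X ⟶ Y) (ρ : Y ⟶ Spec (.of K)) (x : X) (a : K) :
    f.residueFieldMap x (constMap ρ (f x) a) = constMap (f ≫ ρ) x a := by
  rw [constMap, constMap, Scheme.Hom.comp_appTop]
  exact Scheme.Γevaluation_naturality_apply f x (ρ.appTop ((Scheme.ΓSpecIso (.of K)).inv a))

/-- The map `f^an : X^an → Y^an` of a `K`-morphism `f`: the scheme point `x` goes to `f x`, with the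
absolute value restricted along `κ(f x) → κ(x)`. -/
def anMap (f : X ⟶ Y) {π : X ⟶ Spec (.of K)} {ρ : Y ⟶ Spec (.of K)} (hf : f ≫ ρ = π)
    (ξ : An π) : An ρ where
  pt := f ξ.pt
  abv := ξ.abv.comp (f := (f.residueFieldMap ξ.pt).hom) (RingHom.injective _)
  abv_const a ha := by
    have h := ξ.abv_const a ha
    subst hf
    rw [← residueFieldMap_constMap] at h
    exact h

theorem An.abv_natCast_le_one (ξ : An π) (n : ℕ) : ξ.abv (n : X.residueField ξ.pt) ≤ 1 := by
  rw [← map_natCast (constMap π ξ.pt) n]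
  by_cases h : (n : K) = 0
  · rw [h, map_zero, map_zero]; exact zero_le_one
  · exact (ξ.abv_const _ h).le

theorem An.abv_add_le_max (ξ : An π) (a b : X.residueField ξ.pt) :
    ξ.abv (a + b) ≤ max (ξ.abv a) (ξ.abv b) := by
  have : IsUltrametricDist (WithAbs ξ.abv) :=
    IsUltrametricDist.isUltrametricDist_of_forall_norm_natCast_le_one
      fun n => ξ.abv_natCast_le_one n
  exact IsUltrametricDist.norm_add_le_max (WithAbs.toAbs ξ.abv a) (WithAbs.toAbs ξ.abv b)

/-- The valuation ring `𝔬_ξ = {α ∈ κ(ξ) : |α|_ξ ≤ 1}`. -/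
def An.valuationRing (ξ : An π) : ValuationSubring (X.residueField ξ.pt) where
  carrier := {a | ξ.abv a ≤ 1}
  mul_mem' {a b} ha hb := by
    change ξ.abv (a * b) ≤ 1
    rw [map_mul]
    exact mul_le_one₀ ha (ξ.abv.nonneg b) hb
  one_mem' := (map_one ξ.abv).le
  add_mem' {a b} ha hb := (ξ.abv_add_le_max a b).trans (max_le ha hb)
  zero_mem' := by
    change ξ.abv 0 ≤ 1
    rw [map_zero]; exact zero_le_one
  neg_mem' {a} ha := by
    change ξ.abv (-a) ≤ 1
    rw [ξ.abv.map_neg]; exact ha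
  mem_or_inv_mem' a := by
    change ξ.abv a ≤ 1 ∨ ξ.abv a⁻¹ ≤ 1
    rw [map_inv₀]
    rcases le_total (ξ.abv a) 1 with h | h
    · exact Or.inl h
    · exact Or.inr (inv_le_one_of_one_le₀ h)

theorem fromSpecResidueField_comp (π : X ⟶ Spec (.of K)) (x : X) :
    X.fromSpecResidueField x ≫ π = Spec.map (CommRingCat.ofHom (constMap π x)) := by
  have e : X.evaluation ⊤ x trivial = X.presheaf.germ ⊤ x trivial ≫ X.residue x := rfl
  rw [constMap, CommRingCat.ofHom_hom, ← cancel_mono (Spec (.of K)).toSpecΓ, Category.assoc,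
    Scheme.toSpecΓ_naturality, Scheme.fromSpecResidueField, Category.assoc,
    Scheme.fromSpecStalk_toSpecΓ_assoc, e, ← SpecMap_ΓSpecIso_hom]
  simp only [← Spec.map_comp, Category.assoc, Iso.hom_inv_id_assoc]

theorem An.constMap_mem (ξ : An π) (a : K) : constMap π ξ.pt a ∈ ξ.valuationRing.toSubring := by
  change ξ.abv _ ≤ 1
  by_cases h : a = 0
  · rw [h, map_zero, map_zero]; exact zero_le_one
  · exact (ξ.abv_const _ h).le

/-- The valuative criterion of properness: `Spec κ(ξ) → X` extends to `Spec 𝔬_ξ → X`. -/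
theorem An.exists_extension [IsProper π] (ξ : An π) :
    ∃ r : Spec (.of ξ.valuationRing) ⟶ X,
      Spec.map (CommRingCat.ofHom (algebraMap ξ.valuationRing (X.residueField ξ.pt))) ≫ r =
        X.fromSpecResidueField ξ.pt := by
  let ι : K →+* ξ.valuationRing :=
    (constMap π ξ.pt).codRestrict ξ.valuationRing.toSubring ξ.constMap_mem
  have hw : X.fromSpecResidueField ξ.pt ≫ π =
      Spec.map (CommRingCat.ofHom (algebraMap ξ.valuationRing (X.residueField ξ.pt))) ≫
        Spec.map (CommRingCat.ofHom ι) := by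
    rw [fromSpecResidueField_comp, ← Spec.map_comp, ← CommRingCat.ofHom_comp]
    rfl
  have hv : UniversallyClosed π := inferInstance
  rw [UniversallyClosed.eq_valuativeCriterion] at hv
  let S : ValuativeCommSq π :=
    { R := ξ.valuationRing
      K := X.residueField ξ.pt
      i₁ := X.fromSpecResidueField ξ.pt
      i₂ := Spec.map (CommRingCat.ofHom ι)
      commSq := ⟨hw⟩ }
  obtain ⟨⟨r, hr, -⟩⟩ := hv.1 S
  exact ⟨r, hr⟩

/-- The extension `Spec 𝔬_ξ → X` of `Spec κ(ξ) → X` (it is unique as `X` is separated, and it is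
a `K`-morphism as `𝔬_ξ → κ(ξ)` is injective). -/
def An.extension [IsProper π] (ξ : An π) : Spec (.of ξ.valuationRing) ⟶ X :=
  ξ.exists_extension.choose

/-- The reduction point `r_ξ ∈ X`: the image of the maximal ideal of `𝔬_ξ`. -/
def An.reduction [IsProper π] (ξ : An π) : X :=
  ξ.extension (IsLocalRing.closedPoint ξ.valuationRing)

end Berkovich

/-! ### Green functions -/

section Green

variable {K : Type u} [Field K] {X Y : Scheme.{u}} [IsIntegral X] [IsIntegral Y]

/-- The filter on `X^an` generated by the sets `U^an` for `U ⊆ X` non-empty and open (i.e. containing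
the generic point of `X`). -/
def genericFilter (π : X ⟶ Spec (.of K)) : Filter (An π) :=
  Filter.comap An.pt (𝓝 (genericPoint X))

theorem mem_genericFilter (π : X ⟶ Spec (.of K)) (S : Set (An π)) :
    S ∈ genericFilter π ↔ ∃ U : X.Opens, (U : Set X).Nonempty ∧ anSet π U ⊆ S := by
  constructor
  · rintro ⟨t, ht, hS⟩
    obtain ⟨V, hVt, hV, hη⟩ := mem_nhds_iff.mp ht
    exact ⟨⟨V, hV⟩, ⟨_, hη⟩, fun ξ hξ => hS (hVt hξ)⟩
  · rintro ⟨U, hU, hS⟩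
    refine ⟨U, U.isOpen.mem_nhds ?_, hS⟩
    exact ((genericPoint_spec X).mem_open_set_iff U.isOpen).mpr (by simpa using hU)

/-- Real functions on `X^an`, two of them being identified if they agree on `U^an` for some
non-empty Zariski open subset `U` of `X`. -/
abbrev GFun (π : X ⟶ Spec (.of K)) : Type u := Filter.Germ (genericFilter π) ℝ

variable {π : X ⟶ Spec (.of K)}

/-- `g` extends to a continuous function on `U^an`. -/
def ExtendsTo (g : GFun π) (U : X.Opens) : Prop :=
  ∃ θ : An π → ℝ, ContinuousOn θ (anSet π U) ∧ (θ : GFun π) = g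

/-- `g` belongs to `Ĉ⁰(X^an)`: it is a continuous function on `U^an` for a non-empty open `U`. -/
def IsC0 (g : GFun π) : Prop :=
  ∃ U : X.Opens, (U : Set X).Nonempty ∧ ExtendsTo g U

open Classical in
/-- The function `|φ|` of a rational function `φ`, at the points `ξ` where `φ` is regular (and `0` at
the other points). -/
def absFun (π : X ⟶ Spec (.of K)) (φ : X.functionField) (ξ : An π) : ℝ :=
  if h : ∃ s : X.presheaf.stalk ξ.pt, algebraMap _ X.functionField s = φ then
    ξ.abv (X.residue ξ.pt h.choose) else 0

theorem absFun_algebraMap (π : X ⟶ Spec (.of K)) (ξ : An π) (s : X.presheaf.stalk ξ.pt) :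
    absFun π (algebraMap _ X.functionField s) ξ = ξ.abv (X.residue ξ.pt s) := by
  have h : ∃ t : X.presheaf.stalk ξ.pt,
      algebraMap _ X.functionField t = algebraMap _ X.functionField s := ⟨s, rfl⟩
  have hs : h.choose = s :=
    IsFractionRing.injective (X.presheaf.stalk ξ.pt) X.functionField h.choose_spec
  rw [absFun, dif_pos h, hs]

/-- A non-zero rational function is invertible on some `U^an`. -/
theorem eventually_isUnit (π : X ⟶ Spec (.of K)) (φ : (X.functionField)ˣ) :
    ∀ᶠ ξ in genericFilter π, ∃ s : (X.presheaf.stalk (An.pt ξ))ˣ,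
      algebraMap _ X.functionField (s : X.presheaf.stalk (An.pt ξ)) = φ := by
  obtain ⟨U, -, t, hU, ht, hu⟩ := exists_isUnit_germ_eq X (φ : X.functionField) φ.ne_zero
  refine (mem_genericFilter π _).mpr ⟨U, (by simpa using hU), fun ξ hξ => ?_⟩
  refine ⟨(hu.map (X.presheaf.germ U ξ.pt hξ).hom).unit, ?_⟩
  rw [IsUnit.unit_spec, ← ht]
  exact Scheme.algebraMap_germ_eq_germToFunctionField X hξ t

/-- The homomorphism `Rat(X)ˣ → Ĉ⁰(X^an)`, `φ ↦ log |φ|`. -/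
def logAbs (π : X ⟶ Spec (.of K)) : Additive (X.functionField)ˣ →+ GFun π where
  toFun φ := ((fun ξ => Real.log (absFun π (φ.toMul : X.functionField) ξ) : An π → ℝ) : GFun π)
  map_zero' := by
    refine Filter.Germ.coe_eq.mpr (Filter.Eventually.of_forall fun ξ => ?_)
    change Real.log (absFun π 1 ξ) = 0
    rw [← map_one (algebraMap (X.presheaf.stalk ξ.pt) X.functionField), absFun_algebraMap,
      map_one, map_one, Real.log_one]
  map_add' φ ψ := by
    refine Filter.Germ.coe_eq.mpr ?_
    filter_upwards [eventually_isUnit π φ.toMul, eventually_isUnit π ψ.toMul] with ξ hs ht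
    obtain ⟨s, hs⟩ := hs
    obtain ⟨t, ht⟩ := ht
    change Real.log (absFun π ((φ.toMul : X.functionField) * (ψ.toMul : X.functionField)) ξ) =
      Real.log (absFun π (φ.toMul : X.functionField) ξ) +
        Real.log (absFun π (ψ.toMul : X.functionField) ξ)
    rw [← hs, ← ht, ← map_mul, absFun_algebraMap, absFun_algebraMap, absFun_algebraMap, map_mul,
      map_mul]
    exact Real.log_mul
      (ξ.abv.ne_zero (s.isUnit.map (X.residue ξ.pt).hom).ne_zero)
      (ξ.abv.ne_zero (t.isUnit.map (X.residue ξ.pt).hom).ne_zero)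

/-- The `ℝ`-linear map `φ ↦ log |φ|` on `ℝ`-rational functions. -/
def logAbsR (π : X ⟶ Spec (.of K)) : RatR X →ₗ[ℝ] GFun π :=
  (logAbs π).toIntLinearMap.liftBaseChange ℝ

/-- `g` is a Green function (of `C⁰`-type) of `D`: for every local equation `φ` of `D` on a non-empty
open `U`, the element `g + log |φ|` extends to a continuous function on `U^an`. -/
def IsGreen (D : DivR X) (g : GFun π) : Prop :=
  IsC0 g ∧ ∀ (U : X.Opens) (φ : RatR X), (U : Set X).Nonempty → IsLocalEquation D φ U →
    ExtendsTo (g + logAbsR π φ) U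

/-- The value `g(η₀)`, well defined as `η₀` lies in `U^an` for every non-empty open `U`. -/
def valueGeneric (g : GFun π) : ℝ :=
  Filter.Germ.liftOn g (fun h => h (genericAn π)) (by
    intro h₁ h₂ h
    obtain ⟨t, ht, hS⟩ := h
    exact hS (mem_of_mem_nhds ht : genericPoint X ∈ t))

/-- The pullback `(f^an)^*` of elements of `Ĉ⁰`. -/
def pullbackGFun (f : X ⟶ Y) [IsDominant f] {π : X ⟶ Spec (.of K)} {ρ : Y ⟶ Spec (.of K)}
    (hf : f ≫ ρ = π) (g : GFun ρ) : GFun π :=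
  g.compTendsto (anMap f hf) (by
    refine Filter.tendsto_comap_iff.mpr ?_
    have h := f.continuous.tendsto (genericPoint X)
    rw [map_genericPoint f] at h
    exact h.comp Filter.tendsto_comap)

/-- `g` is the canonical Green function of `D` with respect to `f`, where `f^* D = d D + (φ)`: it is
a Green function of `D` and `(f^an)^* g = d g - log |φ|`. -/
def IsCanonicalGreen (f : X ⟶ X) [IsDominant f] (hf : f ≫ π = π) (D : DivR X) (d : ℝ)
    (φ : RatR X) (g : GFun π) : Prop :=
  IsGreen D g ∧ pullbackGFun f hf g = d • g - logAbsR π φ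

/-- `t` is the value at `ξ` of the continuous extension of `g + log |φ|` to `U^an`, where `φ` is
a local equation of `D` on an open set `U` containing the reduction point of `ξ`. -/
def IsHeightValue [IsProper π] (D : DivR X) (g : GFun π) (ξ : An π) (t : ℝ) : Prop :=
  ∃ (U : X.Opens) (φ : RatR X) (θ : An π → ℝ), ξ.reduction ∈ U ∧ IsLocalEquation D φ U ∧
    ContinuousOn θ (anSet π U) ∧ (θ : GFun π) = g + logAbsR π φ ∧ θ ξ = t

/-- The height `h^an_{(D,g)}(ξ)`. For a Green function `g` of `D` the value exists and does not depend
on the choices. -/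
def height [IsProper π] (D : DivR X) (g : GFun π) (ξ : An π) : ℝ :=
  Classical.epsilon (IsHeightValue D g ξ)

/-- The adelic `ℝ`-Cartier divisor `(D, g)` is effective: `D` is effective and `g` is non-negative as
a function `X^an → ℝ ∪ {+∞}`, namely `g = -log E` where `E` is the continuous extension of `e^{-g}`
to `X^an`. -/
def IsAdelicEffective (D : DivR X) (g : GFun π) : Prop :=
  IsEffective D ∧ ∃ E : An π → NNReal, Continuous E ∧
    ((fun ξ => (E ξ : ℝ) : An π → ℝ) : GFun π) = g.map (fun t => Real.exp (-t)) ∧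
    ∀ ξ, 0 ≤ -ENNReal.log (E ξ)

end Green

end

end TrivArakelov

open TrivArakelov

/-! The height is bounded on `X^an` and is multiplied by `d > 1` under `f^an`, so it vanishes
identically (`height_eq_zero`); this yields the assertions on preperiodic points, on the height of
`η₀` and on semiample `D` at once.

Multiplicativity (`height_anMap`): reduction commutes with `f`, and a local equation `ψ` of `D` at
`f(r_ξ)` produces the local equation `d⁻¹(f^*ψ - φ)` of `D` at `r_ξ`; the functional equation of `g`
matches the two continuous extensions. Boundedness (`exists_height_bound`): for `U` affine, the
points reducing into `U` lie in the set where every regular function on `U` has absolute value at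
most one. That set is compact, the height of the points reducing into `U` is given there by one
continuous function, and finitely many `U` cover `X`.

The height is well defined for two reasons. Two local equations at `r_ξ` differ by a real
combination of units at `r_ξ`, and these have absolute value one at `ξ`. Moreover a continuous
function on `U^an` is determined by its germ, since the points over the generic point of `X` are
dense (`dense_generic`). Density is the hardest step: an absolute value on a residue field has to be
approximated, on finitely many elements, by absolute values on the function field `F`. The required
bounds are encoded in a finitely generated algebra of Rees type inside `F((τ))`; Krull's principal
ideal theorem gives a prime of height at most one containing `τ`, and a valuation centred there is
archimedean relative to `τ`, hence yields a real absolute value (`exists_abv_le`).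

For effectivity, the substitution `ψ ↦ d⁻¹(f^*ψ + φ)` keeps `D + (ψ)` effective and divides by `d` a
constant `C` with `g - log|ψ| ≥ -C`; such a `C` exists at the start because `X^an` is compact.
Finally `g(η₀) = 0` because `f^an` fixes `η₀` and every `log|φ|` vanishes there. -/

namespace TrivArakelov

/-! ### Absolute values on fields -/

section RankOne

variable {F Γ : Type*} [Field F] [LinearOrderedCommGroupWithZero Γ] (v : Valuation F Γ) (t : Γ)

/-- The rational upper bounds for the logarithm of `v x` in base `t⁻¹`. -/
def logCut (x : F) : Set ℝ :=
  {r | ∃ (p : ℤ) (q : ℕ), 0 < q ∧ r = p / q ∧ v x ^ q * t ^ p ≤ 1}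

variable {v t}

/-- The archimedean bound on `x⁻¹` says `t ^ m ≤ v x`, which forces `p / q ≥ -m`. The same `m`
serves all `q`, so the infimum of `logCut` is finite and, for fixed `q`, a least admissible `p`
exists. -/
theorem exists_neg_le_of_mem_logCut (ht0 : t ≠ 0) (ht1 : t < 1) {x : F} (hx : x ≠ 0)
    (harch : ∃ m : ℕ, v x⁻¹ * t ^ m ≤ 1) : ∃ m : ℕ, ∀ (p : ℤ) (q : ℕ), v x ^ q * t ^ p ≤ 1 →
      -((m * q : ℕ) : ℤ) ≤ p := by
  obtain ⟨m, hm⟩ := harch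
  refine ⟨m, fun p q h => ?_⟩
  by_contra! hlt
  have hvx : v x ≠ 0 := (v.ne_zero_iff).mpr hx
  have h1 : t ^ m ≤ v x := by
    rw [map_inv₀, inv_mul_le_iff₀ (zero_lt_iff.mpr hvx), mul_one] at hm
    exact hm
  have h2 : t ^ ((m * q : ℕ) : ℤ) * t ^ p ≤ 1 := by
    refine le_trans ?_ h
    gcongr
    rw [zpow_natCast, pow_mul]
    gcongr
  rw [← zpow_add₀ ht0] at h2
  have h3 : 1 < t ^ (((m * q : ℕ) : ℤ) + p) :=
    one_lt_zpow_of_neg₀ (zero_lt_iff.mpr ht0) ht1 (by omega)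
  exact absurd h2 (not_le.mpr h3)

theorem bddBelow_logCut (ht0 : t ≠ 0) (ht1 : t < 1) {x : F} (hx : x ≠ 0)
    (harch : ∃ m : ℕ, v x⁻¹ * t ^ m ≤ 1) : BddBelow (logCut v t x) := by
  obtain ⟨m, hm⟩ := exists_neg_le_of_mem_logCut ht0 ht1 hx harch
  refine ⟨-m, ?_⟩
  rintro _ ⟨p, q, hq, rfl, h⟩
  have := hm p q h
  rw [le_div_iff₀ (by exact_mod_cast hq)]
  have h' : ((-((m * q : ℕ) : ℤ) : ℤ) : ℝ) ≤ p := by exact_mod_cast this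
  push_cast at h'
  linarith

/-- A valuation that is archimedean relative to `t` becomes real-valued by a Dedekind cut: the
infimum `L x` of the rationals `p / q` with `v x ^ q ≤ t ^ (-p)` plays the role of the logarithm of
`v x` in base `t⁻¹`, and `R ^ L x` is the absolute value, normalised so that `t` corresponds to
`R⁻¹`. -/
theorem exists_abv_of_valuation (ht0 : t ≠ 0) (ht1 : t < 1)
    (harch : ∀ x : F, x ≠ 0 → ∃ m : ℕ, v x * t ^ m ≤ 1) {R : ℝ} (hR : 1 < R) :
    ∃ a : AbsoluteValue F ℝ, ∀ (x : F) (n : ℤ), v x * t ^ n ≤ 1 → a x ≤ R ^ n := by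
  classical
  have hR0 : 0 < R := zero_lt_one.trans hR
  have hb (x : F) (hx : x ≠ 0) : BddBelow (logCut v t x) :=
    bddBelow_logCut ht0 ht1 hx (harch _ (inv_ne_zero hx))
  have hne (x : F) (hx : x ≠ 0) : (logCut v t x).Nonempty := by
    obtain ⟨m, hm⟩ := harch x hx
    exact ⟨_, m, 1, one_pos, rfl, by simpa using hm⟩
  let L : F → ℝ := fun x => sInf (logCut v t x)
  have hadd (x y : F) (hx : x ≠ 0) (hy : y ≠ 0) : L (x * y) ≤ L x + L y := by
    have key : ∀ r ∈ logCut v t x, ∀ s ∈ logCut v t y, L (x * y) ≤ r + s := by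
      rintro _ ⟨p, q, hq, rfl, h⟩ _ ⟨p', q', hq', rfl, h'⟩
      refine csInf_le (hb _ (mul_ne_zero hx hy)) ⟨p * q' + p' * q, q * q', by positivity, ?_, ?_⟩
      · have : (q : ℝ) ≠ 0 := by positivity
        have : (q' : ℝ) ≠ 0 := by positivity
        push_cast
        field_simp
      · have e : v (x * y) ^ (q * q') * t ^ (p * q' + p' * q) =
            (v x ^ q * t ^ p) ^ q' * (v y ^ q' * t ^ p') ^ q := by
          rw [map_mul, zpow_add₀ ht0, zpow_mul, zpow_mul, zpow_natCast, zpow_natCast]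
          simp only [mul_pow, ← pow_mul]
          rw [mul_comm q' q]
          exact mul_mul_mul_comm _ _ _ _
        rw [e]
        exact mul_le_one' (pow_le_one' h _) (pow_le_one' h' _)
    have h1 : ∀ s ∈ logCut v t y, L (x * y) - s ≤ L x := fun s hs =>
      le_csInf (hne x hx) fun r hr => by linarith [key r hr s hs]
    have h2 : L (x * y) - L x ≤ L y := le_csInf (hne y hy) fun s hs => by linarith [h1 s hs]
    linarith
  -- For the denominator `q + 1` take the least admissible numerator `p` for `x`. As `p - 1` fails,
  -- `1 - p` is admissible for `x⁻¹`, so the sum is at most `1 / (q + 1)`, which is arbitrarily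
  -- small. With subadditivity this gives additivity of `L`.
  have hinv (x : F) (hx : x ≠ 0) : L x + L x⁻¹ ≤ 0 := by
    refine le_of_forall_pos_le_add fun ε hε => ?_
    obtain ⟨q, hq⟩ := exists_nat_one_div_lt hε
    obtain ⟨m, hm⟩ := exists_neg_le_of_mem_logCut (v := v) ht0 ht1 hx (harch _ (inv_ne_zero hx))
    obtain ⟨m', hm'⟩ := harch (x ^ (q + 1)) (pow_ne_zero _ hx)
    obtain ⟨p, hp, hmin⟩ := Int.exists_least_of_bdd
      (P := fun p : ℤ => v x ^ (q + 1) * t ^ p ≤ 1) ⟨_, fun p h => hm p (q + 1) h⟩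
      ⟨m', by simpa using hm'⟩
    have h1 : L x ≤ (p : ℝ) / (q + 1 : ℕ) := csInf_le (hb x hx) ⟨p, q + 1, by omega, rfl, hp⟩
    have h2 : L x⁻¹ ≤ ((1 - p : ℤ) : ℝ) / (q + 1 : ℕ) := by
      refine csInf_le (hb _ (inv_ne_zero hx)) ⟨1 - p, q + 1, by omega, rfl, ?_⟩
      have h3 : 1 < v x ^ (q + 1) * t ^ (p - 1) := by
        by_contra! h
        exact absurd (hmin _ h) (by omega)
      have h4 : v x⁻¹ ^ (q + 1) * t ^ (1 - p) = (v x ^ (q + 1) * t ^ (p - 1))⁻¹ := by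
        rw [mul_inv, map_inv₀, inv_pow, ← zpow_neg, neg_sub]
      rw [h4]
      exact inv_le_one_of_one_le₀ h3.le
    have h5 : (p : ℝ) / (q + 1 : ℕ) + ((1 - p : ℤ) : ℝ) / (q + 1 : ℕ) = 1 / (q + 1) := by
      push_cast; rw [← add_div]; congr 1; ring
    linarith
  have hmul (x y : F) (hx : x ≠ 0) (hy : y ≠ 0) : L (x * y) = L x + L y := by
    refine le_antisymm (hadd x y hx hy) ?_
    have h1 := hadd (x * y) y⁻¹ (mul_ne_zero hx hy) (inv_ne_zero hy)
    rw [mul_inv_cancel_right₀ hy] at h1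
    linarith [hinv y hy]
  have hmono (x y : F) (hx : x ≠ 0) (hy : y ≠ 0) (h : v y ≤ v x) : L y ≤ L x := by
    refine csInf_le_csInf (hb y hy) (hne x hx) ?_
    rintro _ ⟨p, q, hq, rfl, h'⟩
    exact ⟨p, q, hq, rfl, le_trans (by gcongr) h'⟩
  refine ⟨⟨⟨fun x => if x = 0 then 0 else R ^ L x, fun x y => ?_⟩, fun x => ?_, fun x => ?_,
    fun x y => ?_⟩, fun x n h => ?_⟩
  · by_cases hx : x = 0
    · simp [hx]
    by_cases hy : y = 0
    · simp [hy]
    simp only [hx, hy, mul_eq_zero, or_self, if_false]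
    rw [hmul x y hx hy, Real.rpow_add hR0]
  · dsimp only
    split_ifs
    · exact le_rfl
    · positivity
  · dsimp only
    split_ifs with hx
    · simp [hx]
    · simpa [hx] using (Real.rpow_pos_of_pos hR0 _).ne'
  · dsimp only
    by_cases hx : x = 0
    · simp [hx]
    by_cases hy : y = 0
    · simp [hy]
    by_cases hxy : x + y = 0
    · simp only [hxy, hx, hy, if_true, if_false]; positivity
    simp only [hx, hy, hxy, if_false]
    have hpx := Real.rpow_pos_of_pos hR0 (L x)
    have hpy := Real.rpow_pos_of_pos hR0 (L y)
    rcases le_max_iff.mp (v.map_add x y) with h | h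
    · have := Real.rpow_le_rpow_of_exponent_le hR.le (hmono x _ hx hxy h)
      linarith
    · have := Real.rpow_le_rpow_of_exponent_le hR.le (hmono y _ hy hxy h)
      linarith
  · change (if x = 0 then 0 else R ^ L x) ≤ R ^ n
    split_ifs with hx
    · positivity
    · rw [← Real.rpow_intCast]
      refine Real.rpow_le_rpow_of_exponent_le hR.le ?_
      exact csInf_le (hb x hx) ⟨n, 1, one_pos, by simp, by simpa using h⟩

end RankOne

end TrivArakelov

namespace TrivArakelov

/-! ### Approximating absolute values on a residue field by absolute values on the fraction field -/

section ExistsAbv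

/-- In a Noetherian domain, a prime minimal over a non-unit `t` is such that every non-zero element
divides a power of `t` up to an element outside of the prime. -/
theorem exists_prime_dvd_pow {B : Type*} [CommRing B] [IsDomain B] [IsNoetherianRing B] (t : B)
    (ht : ¬ IsUnit t) : ∃ Q : Ideal B, Q.IsPrime ∧ t ∈ Q ∧ ∀ h : B, h ≠ 0 →
      ∃ (m : ℕ) (u : B), u ∉ Q ∧ h ∣ t ^ m * u := by
  have hne : Ideal.span {t} ≠ ⊤ := by rwa [Ne, Ideal.span_singleton_eq_top]
  obtain ⟨M, hM, hle⟩ := Ideal.exists_le_maximal _ hne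
  obtain ⟨Q, hQ, -⟩ := Ideal.exists_minimalPrimes_le hle
  have hQp : Q.IsPrime := hQ.1.1
  have htQ : t ∈ Q := hQ.1.2 (Ideal.mem_span_singleton_self t)
  refine ⟨Q, hQp, htQ, fun h hh => ?_⟩
  by_contra! hcon
  -- If no `t ^ m * u` were a multiple of `h`, some prime `P` containing `h` would avoid `t` and the
  -- complement of `Q`, so `P < Q` strictly. Since `Q` has height at most one by Krull's theorem,
  -- `P` would be zero, contradicting `h ≠ 0`.
  have hdisj : Disjoint (Ideal.span {h} : Set B)
      (Submonoid.powers t ⊔ Q.primeCompl : Submonoid B) := by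
    rw [Set.disjoint_left]
    rintro x hx hx'
    obtain ⟨_, ⟨m, rfl⟩, u, hu, rfl⟩ := Submonoid.mem_sup.mp hx'
    exact hcon m u hu (Ideal.mem_span_singleton.mp hx)
  obtain ⟨P, hP, hhP, hPd⟩ := Ideal.exists_le_prime_disjoint _ _ hdisj
  rw [Set.disjoint_left] at hPd
  have htP : t ∉ P := fun h' => hPd h' (Submonoid.mem_sup_left (Submonoid.mem_powers t))
  have hPQ : P < Q := by
    refine lt_of_le_of_ne (fun x hx => ?_) (fun e => htP (e ▸ htQ))
    by_contra hxQ
    exact hPd hx (Submonoid.mem_sup_right hxQ)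
  have h1 := Ideal.height_le_one_of_isPrincipal_of_mem_minimalPrimes _ Q hQ
  have h2 := Ideal.height_add_one_le_of_lt_of_isPrime hPQ
  have h3 : P.height + 1 ≤ 0 + 1 := by simpa using h2.trans h1
  have h4 : P.height = 0 := by
    simpa using (ENat.add_le_add_iff_right ENat.one_ne_top).mp h3
  rw [Ideal.height_eq_zero_iff_eq_bot] at h4
  rw [h4, Ideal.span_le, Set.singleton_subset_iff] at hhP
  exact hh hhP

/-- Take a valuation ring dominating the localisation of `A` at `Q`: elements of `Q` fall into its
maximal ideal, while elements outside `Q` are already units of the localisation. -/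
theorem exists_valuationSubring_dominating {E : Type*} [Field E] (A : Subring E) (Q : Ideal A)
    [Q.IsPrime] : ∃ V : ValuationSubring E, (∀ x : A, V.valuation x ≤ 1) ∧
      (∀ x ∈ Q, V.valuation (x : E) < 1) ∧ ∀ x : A, x ∉ Q → V.valuation (x : E) = 1 := by
  obtain ⟨V, hV⟩ := (LocalSubring.ofPrime A Q).exists_le_valuationSubring
  have hAV (x : A) : V.valuation (x : E) ≤ 1 :=
    (V.valuation_le_one_iff _).mpr (hV.1 (LocalSubring.le_ofPrime A Q x.2))
  refine ⟨V, hAV, fun x hx => ?_, fun x hx => ?_⟩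
  · have h1 : (x : E) ∈ V.nonunits := by
      rw [← SetLike.mem_coe, ← V.image_maximalIdeal]
      refine Set.image_mono (((IsLocalRing.local_hom_TFAE _).out 0 2).mp hV.2) ?_
      rw [← IsLocalization.AtPrime.map_eq_maximalIdeal Q, Ideal.map_map]
      exact ⟨_, Ideal.mem_map_of_mem _ hx, rfl⟩
    exact h1
  · refine le_antisymm (hAV x) ?_
    have hu : IsUnit (algebraMap A (LocalSubring.ofPrime A Q).toSubring x) :=
      IsLocalization.map_units _ (⟨x, hx⟩ : Q.primeCompl)
    obtain ⟨y, hy⟩ := hu.exists_right_inv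
    have hy' : (x : E) * (y : E) = 1 := congrArg Subtype.val hy
    have hyV : V.valuation (y : E) ≤ 1 := (V.valuation_le_one_iff _).mpr (hV.1 y.2)
    rw [← map_one V.valuation, ← hy', map_mul]
    exact mul_le_of_le_one_right' hyV

variable {K F O κ : Type*} [Field K] [Field F] [Algebra K F] [CommRing O] [Algebra O F] [Field κ]

theorem laurentSeries_algebraMap (c : K) :
    algebraMap K (LaurentSeries F) c = HahnSeries.C (algebraMap K F c) := by
  rw [HahnSeries.algebraMap_apply', ← HahnSeries.ofPowerSeries_C, PowerSeries.algebraMap_apply]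

/-- The Laurent series over the fraction field of `O` whose coefficients satisfy the bounds defining
the unit ball of a Gauss norm. -/
def gaussBall (res : O →+* κ) (a : AbsoluteValue κ ℝ) (hna : ∀ x y, a (x + y) ≤ max (a x) (a y))
    (hK : ∀ c : K, ∃ o, algebraMap O F o = algebraMap K F c ∧ a (res o) ≤ 1) {R : ℝ} (hR : 1 < R) :
    Subalgebra K (LaurentSeries F) where
  carrier := {p | ∀ k : ℤ, ∃ o, algebraMap O F o = p.coeff k ∧ a (res o) ≤ R ^ k}
  mul_mem' {p q} hp hq k := by
    have hR0 : 0 < R := zero_lt_one.trans hR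
    -- By the ultrametric inequality the admissible values of the `k`-th coefficient are closed
    -- under sums, so it suffices to treat each term of the Cauchy product, where the bounds `R ^ i`
    -- and `R ^ j` multiply to `R ^ k`.
    let J : AddSubmonoid F :=
      { carrier := {x | ∃ o, algebraMap O F o = x ∧ a (res o) ≤ R ^ k}
        zero_mem' := ⟨0, map_zero _, by simp only [map_zero]; positivity⟩
        add_mem' := by
          rintro _ _ ⟨o, rfl, ho⟩ ⟨o', rfl, ho'⟩
          exact ⟨o + o', map_add _ _ _, by rw [map_add]; exact (hna _ _).trans (max_le ho ho')⟩ }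
    change (p * q).coeff k ∈ J
    rw [HahnSeries.coeff_mul]
    refine sum_mem fun ij hij => ?_
    obtain ⟨o, ho, h⟩ := hp ij.1
    obtain ⟨o', ho', h'⟩ := hq ij.2
    refine ⟨o * o', by rw [map_mul, ho, ho'], ?_⟩
    rw [map_mul, map_mul, ← (Finset.mem_antidiagonal.mp hij).2.2, zpow_add₀ hR0.ne']
    gcongr
  add_mem' {p q} hp hq k := by
    obtain ⟨o, ho, h⟩ := hp k
    obtain ⟨o', ho', h'⟩ := hq k
    refine ⟨o + o', by rw [map_add, ho, ho', HahnSeries.coeff_add], ?_⟩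
    rw [map_add]; exact (hna _ _).trans (max_le h h')
  algebraMap_mem' c k := by
    have hR0 : 0 < R := zero_lt_one.trans hR
    obtain ⟨o, ho, h⟩ := hK c
    rw [laurentSeries_algebraMap, HahnSeries.C_apply, HahnSeries.coeff_single]
    split_ifs with hk
    · exact ⟨o, ho, by simpa [hk] using h⟩
    · exact ⟨0, map_zero _, by simp only [map_zero]; positivity⟩

theorem single_mem_gaussBall (res : O →+* κ) (a : AbsoluteValue κ ℝ)
    (hna : ∀ x y, a (x + y) ≤ max (a x) (a y))
    (hK : ∀ c : K, ∃ o, algebraMap O F o = algebraMap K F c ∧ a (res o) ≤ 1) {R : ℝ} (hR : 1 < R)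
    (n : ℤ) (x : F) (hx : ∃ o, algebraMap O F o = x ∧ a (res o) ≤ R ^ n) :
    HahnSeries.single n x ∈ gaussBall res a hna hK hR := by
  intro k
  rw [HahnSeries.coeff_single]
  split_ifs with hk
  · rwa [hk]
  · exact ⟨0, map_zero _, by simp only [map_zero]; have := zero_lt_one.trans hR; positivity⟩

/-- Approximation of an absolute value on the residue field of a local ring by absolute values on its
fraction field. -/
theorem exists_abv_le (hinj : Function.Injective (algebraMap O F)) (res : O →+* κ)
    (a : AbsoluteValue κ ℝ) (hna : ∀ x y, a (x + y) ≤ max (a x) (a y))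
    (hK : ∀ c : K, ∃ o, algebraMap O F o = algebraMap K F c ∧ a (res o) ≤ 1) {R : ℝ} (hR : 1 < R)
    (P : Set (F × ℤ)) (hPfin : P.Finite)
    (hP : ∀ p ∈ P, ∃ o, algebraMap O F o = p.1 ∧ a (res o) ≤ R ^ p.2)
    (hgen : ∀ x : F, ∃ y ∈ Algebra.adjoin K (Prod.fst '' P), ∃ z ∈ Algebra.adjoin K (Prod.fst '' P),
      z ≠ 0 ∧ x = y / z) :
    ∃ b : AbsoluteValue F ℝ, (∀ c : K, c ≠ 0 → b (algebraMap K F c) = 1) ∧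
      ∀ p ∈ P, b p.1 ≤ R ^ p.2 := by
  have hR0 : 0 < R := zero_lt_one.trans hR
  let τ : LaurentSeries F := HahnSeries.single 1 1
  have hτ0 : τ ≠ 0 := HahnSeries.single_ne_zero one_ne_zero
  have hτz (n : ℤ) (x : F) : HahnSeries.single n x = HahnSeries.C x * τ ^ n := by
    rw [← RatFunc.single_zpow, HahnSeries.C_apply, HahnSeries.single_mul_single]
    simp
  -- The desired inequality `b x ≤ R ^ n` becomes integrality of the monomial `x τ ^ n` for a
  -- valuation with `τ ↦ R⁻¹`. The algebra `B` generated by `τ` and these monomials is Noetherian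
  -- and lies in the Gauss unit ball.
  let S : Set (LaurentSeries F) := insert τ ((fun p : F × ℤ => HahnSeries.single p.2 p.1) '' P)
  have hSfin : S.Finite := (hPfin.image _).insert _
  let B : Subalgebra K (LaurentSeries F) := Algebra.adjoin K S
  have hBG : B ≤ gaussBall res a hna hK hR := by
    refine Algebra.adjoin_le ?_
    rintro _ (rfl | ⟨p, hp, rfl⟩)
    · exact single_mem_gaussBall res a hna hK hR 1 1 ⟨1, map_one _, by simpa using hR.le⟩
    · exact single_mem_gaussBall res a hna hK hR _ _ (hP p hp)
  have hτB : τ ∈ B := Algebra.subset_adjoin (Set.mem_insert _ _)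
  have hPB (p : F × ℤ) (hp : p ∈ P) : HahnSeries.single p.2 p.1 ∈ B :=
    Algebra.subset_adjoin (Set.mem_insert_of_mem _ ⟨p, hp, rfl⟩)
  have : Algebra.FiniteType K B :=
    B.fg_iff_finiteType.mp ⟨hSfin.toFinset, by rw [Set.Finite.coe_toFinset]⟩
  have : IsNoetherianRing B := Algebra.FiniteType.isNoetherianRing K B
  -- The Gauss ball does not contain `τ⁻¹`: its coefficient `1` in degree `-1` would need absolute
  -- value at most `R⁻¹ < 1`. This is where the given absolute value `a` enters.
  have hτu : ¬ IsUnit (⟨τ, hτB⟩ : B) := by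
    intro hu
    obtain ⟨y, hy⟩ := hu.exists_right_inv
    have hy' : τ * (y : LaurentSeries F) = 1 := congrArg Subtype.val hy
    have hy2 : (y : LaurentSeries F) = HahnSeries.single (-1) 1 := by
      rw [hτz, map_one, one_mul, zpow_neg_one]
      exact eq_inv_of_mul_eq_one_right hy'
    obtain ⟨o, ho, h⟩ := hBG y.2 (-1)
    rw [hy2, HahnSeries.coeff_single_same, ← map_one (algebraMap O F)] at ho
    rw [hinj ho, map_one, map_one, zpow_neg_one] at h
    exact absurd h (not_le.mpr (inv_lt_one_of_one_lt₀ hR))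
  obtain ⟨Q, hQ, hτQ, hdiv⟩ := exists_prime_dvd_pow _ hτu
  obtain ⟨V, hV1, hV2, hV3⟩ :=
    exists_valuationSubring_dominating (A := B.toSubring) (Q : Ideal B.toSubring)
  have hVB (x : LaurentSeries F) (hx : x ∈ B) : V.valuation x ≤ 1 := hV1 ⟨x, hx⟩
  have hV2' := hV2 _ hτQ
  let t := V.valuation τ
  have ht0 : t ≠ 0 := (V.valuation.ne_zero_iff).mpr hτ0
  have ht1 : t < 1 := hV2'
  let v : Valuation F _ := V.valuation.comap (HahnSeries.C : F →+* LaurentSeries F)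
  -- Elements of the algebra generated by the first components enter `B` after multiplication by a
  -- power of `τ`, which absorbs the exponents `n`.
  have hmemB (y : F) (hy : y ∈ Algebra.adjoin K (Prod.fst '' P)) :
      ∃ m : ℕ, HahnSeries.C y * τ ^ m ∈ B := by
    induction hy using Algebra.adjoin_induction with
    | mem x hx =>
      obtain ⟨p, hp, rfl⟩ := hx
      refine ⟨p.2.toNat, ?_⟩
      have h1 : HahnSeries.C p.1 * τ ^ p.2.toNat =
          HahnSeries.single p.2 p.1 * τ ^ ((p.2.toNat : ℤ) - p.2).toNat := by
        rw [hτz, mul_assoc, ← zpow_natCast, ← zpow_natCast, ← zpow_add₀ hτ0]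
        congr 2
        omega
      rw [h1]
      exact B.mul_mem (hPB p hp) (B.pow_mem hτB _)
    | algebraMap c =>
      refine ⟨0, ?_⟩
      rw [pow_zero, mul_one, ← laurentSeries_algebraMap]
      exact B.algebraMap_mem c
    | add x y _ _ hx hy =>
      obtain ⟨m, hm⟩ := hx
      obtain ⟨n, hn⟩ := hy
      refine ⟨m + n, ?_⟩
      have : HahnSeries.C (x + y) * τ ^ (m + n) =
        HahnSeries.C x * τ ^ m * τ ^ n + HahnSeries.C y * τ ^ n * τ ^ m := by
        rw [map_add]; ring
      rw [this]
      exact B.add_mem (B.mul_mem hm (B.pow_mem hτB _)) (B.mul_mem hn (B.pow_mem hτB _))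
    | mul x y _ _ hx hy =>
      obtain ⟨m, hm⟩ := hx
      obtain ⟨n, hn⟩ := hy
      refine ⟨m + n, ?_⟩
      have : HahnSeries.C (x * y) * τ ^ (m + n) =
        HahnSeries.C x * τ ^ m * (HahnSeries.C y * τ ^ n) := by
        rw [map_mul]; ring
      rw [this]
      exact B.mul_mem hm hn
  -- For `x = y / z`, the numerator is bounded because some `y τ ^ m` lies in `B`. The denominator
  -- is bounded below because some `z τ ^ n` divides `τ ^ k u` in `B` with `u ∉ Q`, and such a `u`
  -- has value one.
  have harch (x : F) (hx : x ≠ 0) : ∃ m : ℕ, v x * t ^ m ≤ 1 := by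
    obtain ⟨y, hy, z, hz, hz0, rfl⟩ := hgen x
    obtain ⟨m, hm⟩ := hmemB y hy
    obtain ⟨n, hn⟩ := hmemB z hz
    obtain ⟨k, u, hu, ⟨c, hc⟩⟩ := hdiv ⟨_, hn⟩ (by
      intro h0
      have h0' := congrArg Subtype.val h0
      exact mul_ne_zero ((map_ne_zero HahnSeries.C).mpr hz0) (pow_ne_zero _ hτ0) h0')
    have hc' : τ ^ k * (u : LaurentSeries F) = HahnSeries.C z * τ ^ n * (c : LaurentSeries F) :=
      congrArg Subtype.val hc
    have hu1 : V.valuation (u : LaurentSeries F) = 1 := hV3 u hu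
    have h1 : t ^ k ≤ v z := by
      have h2 := congrArg V.valuation hc'
      rw [map_mul, map_mul, map_mul, hu1, mul_one, map_pow, map_pow] at h2
      change t ^ k = v z * t ^ n * _ at h2
      rw [h2, mul_assoc]
      exact mul_le_of_le_one_right' (mul_le_one' (pow_le_one' ht1.le _) (hVB c c.2))
    have h2 : v y * t ^ m ≤ 1 := by
      have := hVB _ hm
      rwa [map_mul, map_pow] at this
    have hvz : v z ≠ 0 := (v.ne_zero_iff).mpr hz0
    refine ⟨m + k, ?_⟩
    rw [map_div₀, pow_add, div_mul_eq_mul_div, div_le_one₀ (zero_lt_iff.mpr hvz), ← mul_assoc]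
    exact (mul_le_of_le_one_left' h2).trans h1
  obtain ⟨b, hb⟩ := exists_abv_of_valuation (v := v) ht0 ht1 harch hR
  have hbK (c : K) : b (algebraMap K F c) ≤ 1 := by
    rw [← zpow_zero R]
    refine hb _ 0 ?_
    rw [zpow_zero, mul_one]
    exact hVB _ (laurentSeries_algebraMap (F := F) c ▸ B.algebraMap_mem c)
  refine ⟨b, fun c hc => le_antisymm (hbK c) ?_, fun p hp => hb _ _ ?_⟩
  · have h1 := hbK c⁻¹
    rw [map_inv₀, map_inv₀] at h1
    have h2 : 0 < b (algebraMap K F c) := b.pos ((map_ne_zero _).mpr hc)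
    exact (inv_le_one₀ h2).mp h1
  · have h1 := hVB _ (hPB p hp)
    rwa [hτz, map_mul, map_zpow₀] at h1

/-- Approximation of finitely many values of an absolute value on the residue field of a local ring by
those of an absolute value on its fraction field. -/
theorem exists_abv_near (hinj : Function.Injective (algebraMap O F)) (res : O →+* κ)
    (hloc : ∀ o, res o ≠ 0 → IsUnit o)
    (a : AbsoluteValue κ ℝ) (hna : ∀ x y, a (x + y) ≤ max (a x) (a y))
    (hK : ∀ c : K, ∃ o, algebraMap O F o = algebraMap K F c ∧ a (res o) ≤ 1)
    (G : Set O) (hG : G.Finite)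
    (hgen : ∀ x : F, ∃ y ∈ Algebra.adjoin K (algebraMap O F '' G),
      ∃ z ∈ Algebra.adjoin K (algebraMap O F '' G), z ≠ 0 ∧ x = y / z) {ε : ℝ} (hε : 0 < ε) :
    ∃ b : AbsoluteValue F ℝ, (∀ c : K, c ≠ 0 → b (algebraMap K F c) = 1) ∧
      ∀ o ∈ G, |b (algebraMap O F o) - a (res o)| < ε := by
  obtain ⟨M, hM0, hM⟩ : ∃ M : ℝ, 0 < M ∧ ∀ o ∈ G, a (res o) ≤ M := by
    obtain ⟨M, hM⟩ := (hG.image fun o => a (res o)).bddAbove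
    exact ⟨max M 1, by positivity, fun o ho => (hM ⟨o, ho, rfl⟩).trans (le_max_left _ _)⟩
  -- The ratio `R` is so close to one that an interval `[R ^ (n - 1), R ^ n]` with `R ^ (n - 1) ≤ M`
  -- is shorter than `ε`.
  let R : ℝ := 1 + ε / (2 * M)
  have hR : 1 < R := by simp only [R]; linarith [show 0 < ε / (2 * M) by positivity]
  have hR0 : 0 < R := zero_lt_one.trans hR
  have hMR : M * (R - 1) < ε := by
    simp only [R]; field_simp; linarith
  have hn (o : O) : ∃ n : ℤ, (a (res o) = 0 → R ^ n < ε) ∧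
      (a (res o) ≠ 0 → R ^ (n - 1) ≤ a (res o)) ∧ a (res o) ≤ R ^ n := by
    by_cases h : a (res o) = 0
    · obtain ⟨k, hk⟩ := exists_pow_lt_of_lt_one hε (inv_lt_one_of_one_lt₀ hR)
      refine ⟨-k, fun _ => ?_, fun h' => absurd h h', ?_⟩
      · rw [zpow_neg, zpow_natCast, ← inv_pow]; exact hk
      · rw [h]; positivity
    · obtain ⟨k, hk, hk'⟩ := exists_mem_Ico_zpow
        (lt_of_le_of_ne (a.nonneg _) (Ne.symm h)) hR
      exact ⟨k + 1, fun h' => absurd h' h, fun _ => by simpa using hk, hk'.le⟩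
  choose n hn0 hn1 hn2 using hn
  let P1 : Set (F × ℤ) := (fun o => (algebraMap O F o, n o)) '' G
  -- Lower bounds on `b o` are upper bounds on the inverse: an element with non-zero residue is a
  -- unit of the local ring, so its inverse may be prescribed as well.
  let P2 : Set (F × ℤ) := (fun o => ((algebraMap O F o)⁻¹, 1 - n o)) '' {o ∈ G | a (res o) ≠ 0}
  have hsub : algebraMap O F '' G ⊆ Prod.fst '' (P1 ∪ P2) := by
    rintro _ ⟨o, ho, rfl⟩
    exact ⟨_, Or.inl ⟨o, ho, rfl⟩, rfl⟩
  obtain ⟨b, hb1, hb2⟩ := exists_abv_le hinj res a hna hK hR (P1 ∪ P2)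
    ((hG.image _).union ((hG.subset (Set.sep_subset _ _)).image _)) (by
      rintro _ (⟨o, ho, rfl⟩ | ⟨o, ⟨ho, ho'⟩, rfl⟩)
      · exact ⟨o, rfl, hn2 o⟩
      · have hne : res o ≠ 0 := fun h => ho' (by rw [h, map_zero])
        obtain ⟨u, hu⟩ := hloc o hne
        refine ⟨↑u⁻¹, ?_, ?_⟩
        · rw [← hu]
          exact (inv_eq_of_mul_eq_one_right (by rw [← map_mul, Units.mul_inv, map_one])).symm
        · have h1 : a (res (↑u⁻¹ : O)) = (a (res o))⁻¹ := by
            rw [← hu, ← map_inv₀]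
            exact congrArg a (inv_eq_of_mul_eq_one_right
              (by rw [← map_mul, Units.mul_inv, map_one])).symm
          change a (res (↑u⁻¹ : O)) ≤ R ^ (1 - n o)
          rw [h1, ← neg_sub, zpow_neg]
          exact inv_anti₀ (by positivity) (hn1 o ho'))
    (fun x => by
      obtain ⟨y, hy, z, hz, h⟩ := hgen x
      exact ⟨y, Algebra.adjoin_mono hsub hy, z, Algebra.adjoin_mono hsub hz, h⟩)
  refine ⟨b, hb1, fun o ho => ?_⟩
  have h1 : b (algebraMap O F o) ≤ R ^ n o := hb2 _ (Or.inl ⟨o, ho, rfl⟩)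
  by_cases h : a (res o) = 0
  · rw [h, sub_zero, abs_of_nonneg (b.nonneg _)]
    exact h1.trans_lt (hn0 o h)
  · have h2 : b (algebraMap O F o)⁻¹ ≤ R ^ (1 - n o) := hb2 _ (Or.inr ⟨o, ⟨ho, h⟩, rfl⟩)
    have hpos : 0 < b (algebraMap O F o) := by
      refine b.pos fun h0 => h ?_
      rw [hinj (h0.trans (map_zero _).symm), map_zero, map_zero]
    have h3 : R ^ (n o - 1) ≤ b (algebraMap O F o) := by
      rw [map_inv₀, ← neg_sub, zpow_neg] at h2
      exact (inv_le_inv₀ hpos (by positivity)).mp h2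
    have h4 : R ^ n o = R ^ (n o - 1) * R := by
      rw [← zpow_add_one₀ hR0.ne']; simp
    have h5 : R ^ (n o - 1) * (R - 1) < ε :=
      lt_of_le_of_lt (mul_le_mul_of_nonneg_right ((hn1 o h).trans (hM o ho)) (by linarith)) hMR
    rw [abs_lt]
    constructor <;> nlinarith [hn1 o h, hn2 o]

end ExistsAbv

end TrivArakelov

namespace TrivArakelov

noncomputable section

/-! ### The topology of Berkovich spaces -/

section AnTopology

variable {K : Type u} [Field K] {X Y : Scheme.{u}} {π : X ⟶ Spec (.of K)}

theorem isOpen_anSet (U : X.Opens) : IsOpen (anSet π U) :=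
  TopologicalSpace.isOpen_generateFrom_of_mem (Or.inl ⟨U, rfl⟩)

open Classical in
/-- The absolute value of a regular function at the points of its domain (and `0` elsewhere). -/
def evalAbs {U : X.Opens} (s : Γ(X, U)) (ξ : An π) : ℝ :=
  if h : ξ.pt ∈ U then ξ.abv (X.evaluation U ξ.pt h s) else 0

theorem evalAbs_of_mem {U : X.Opens} (s : Γ(X, U)) (ξ : An π) (h : ξ.pt ∈ U) :
    evalAbs s ξ = ξ.abv (X.evaluation U ξ.pt h s) := dif_pos h

theorem continuousOn_evalAbs {U : X.Opens} (s : Γ(X, U)) :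
    ContinuousOn (evalAbs s : An π → ℝ) (anSet π U) := by
  rw [continuousOn_open_iff (isOpen_anSet U)]
  intro V hV
  refine TopologicalSpace.isOpen_generateFrom_of_mem (Or.inr ⟨U, s, V, hV, ?_⟩)
  ext ξ
  constructor
  · rintro ⟨h, h'⟩
    refine ⟨h, ?_⟩
    rwa [Set.mem_preimage, evalAbs_of_mem s ξ h] at h'
  · rintro ⟨h, h'⟩
    refine ⟨h, ?_⟩
    rwa [Set.mem_preimage, evalAbs_of_mem s ξ h]

theorem continuous_anMap (f : X ⟶ Y) {ρ : Y ⟶ Spec (.of K)} (hf : f ≫ ρ = π) :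
    Continuous (anMap f hf) := by
  rw [continuous_generateFrom_iff]
  rintro S (⟨U, rfl⟩ | ⟨U, s, V, hV, rfl⟩)
  · exact isOpen_anSet (f ⁻¹ᵁ U)
  · refine TopologicalSpace.isOpen_generateFrom_of_mem (Or.inr ⟨f ⁻¹ᵁ U, f.app U s, V, hV, ?_⟩)
    ext ξ
    refine exists_congr fun h => ?_
    rw [← Scheme.evaluation_naturality_apply f ξ.pt h s]
    rfl

/-- The structure homomorphism `K → Γ(X, U)`. -/
def constSec (π : X ⟶ Spec (.of K)) (U : X.Opens) : K →+* Γ(X, U) :=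
  ((Scheme.ΓSpecIso (.of K)).inv ≫ π.appLE ⊤ U le_top).hom

theorem appLE_top_germ (π : X ⟶ Spec (.of K)) (U : X.Opens) (x : X) (hx : x ∈ U) :
    π.appLE ⊤ U le_top ≫ X.presheaf.germ U x hx = π.appTop ≫ X.presheaf.germ ⊤ x trivial := by
  simp only [Scheme.Hom.appLE, Category.assoc, TopCat.Presheaf.germ_res]
  rfl

theorem germ_constSec (π : X ⟶ Spec (.of K)) (U : X.Opens) (x : X) (hx : x ∈ U) (c : K) :
    X.presheaf.germ U x hx (constSec π U c) =
      X.presheaf.germ ⊤ x trivial (constSec π ⊤ c) :=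
  congr($((appLE_top_germ π U x hx).trans (appLE_top_germ π ⊤ x trivial).symm).hom
    ((Scheme.ΓSpecIso (.of K)).inv c))

theorem evaluation_constSec (π : X ⟶ Spec (.of K)) (U : X.Opens) (x : X) (hx : x ∈ U) (c : K) :
    X.evaluation U x hx (constSec π U c) = constMap π x c :=
  congrArg (X.residue x) congr($(appLE_top_germ π U x hx).hom ((Scheme.ΓSpecIso (.of K)).inv c))

theorem finiteType_constSec [LocallyOfFiniteType π] {U : X.Opens} (hU : IsAffineOpen U) :
    (constSec π U).FiniteType := by
  have h1 := LocallyOfFiniteType.finiteType_appLE π (isAffineOpen_top (Spec (.of K))) hU le_top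
  have h2 : Function.Surjective (Scheme.ΓSpecIso (.of K)).inv :=
    (ConcreteCategory.isIso_iff_bijective _).mp inferInstance |>.2
  exact h1.comp (RingHom.FiniteType.of_surjective _ h2)

end AnTopology

/-! ### Density of the points over the generic point -/

section Density

variable {K : Type u} [Field K] {X : Scheme.{u}} [IsIntegral X] {π : X ⟶ Spec (.of K)}

theorem genericPoint_mem {U : X.Opens} (hU : (U : Set X).Nonempty) : genericPoint X ∈ U :=
  ((genericPoint_spec X).mem_open_set_iff U.isOpen).mpr (by simpa using hU)

theorem algebraMap_germ {U : X.Opens} (x : X) (hx : x ∈ U) (s : Γ(X, U)) :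
    algebraMap (X.presheaf.stalk x) X.functionField (X.presheaf.germ U x hx s) =
      X.presheaf.germ U (genericPoint X) (genericPoint_mem ⟨x, hx⟩) s :=
  have : Nonempty U := ⟨⟨x, hx⟩⟩
  Scheme.algebraMap_germ_eq_germToFunctionField X hx s

theorem residue_genericPoint_bijective :
    Function.Bijective (X.residue (genericPoint X)).hom :=
  ⟨RingHom.injective (R := X.functionField) (X.residue (genericPoint X)).hom,
    X.residue_surjective (genericPoint X)⟩

/-- The function field as the residue field of the generic point. -/
def functionFieldEquiv : X.functionField ≃+* X.residueField (genericPoint X) :=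
  RingEquiv.ofBijective (X.residue (genericPoint X)).hom residue_genericPoint_bijective

/-- The structure homomorphism of the function field. -/
def constFF (π : X ⟶ Spec (.of K)) : K →+* X.functionField :=
  (X.presheaf.germ ⊤ (genericPoint X) trivial).hom.comp (constSec π ⊤)

/-- The point of `X^an` given by an absolute value on the function field. -/
def genericPointAn (π : X ⟶ Spec (.of K)) (b : AbsoluteValue X.functionField ℝ)
    (hb : ∀ c : K, c ≠ 0 → b (constFF π c) = 1) : An π where
  pt := genericPoint X
  abv := b.comp (f := (functionFieldEquiv (X := X)).symm.toRingHom) (RingEquiv.injective _)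
  abv_const c hc := by
    rw [← hb c hc]
    refine congrArg b ?_
    change functionFieldEquiv.symm _ = _
    rw [RingEquiv.symm_apply_eq, ← evaluation_constSec π ⊤ _ trivial]
    rfl

theorem evaluation_genericPointAn (b : AbsoluteValue X.functionField ℝ)
    (hb : ∀ c : K, c ≠ 0 → b (constFF π c) = 1) (U : X.Opens)
    (h : (genericPointAn π b hb).pt ∈ U) (s : Γ(X, U)) :
    (genericPointAn π b hb).abv (X.evaluation U _ h s) =
      b (X.presheaf.germ U (genericPoint X) h s) := by
  refine congrArg b ?_
  exact functionFieldEquiv.symm_apply_apply (X.presheaf.germ U (genericPoint X) h s)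

/-- An affine neighbourhood of `x` has a coordinate ring of finite type over `K` whose fraction
field is the function field; the germs at `x` of its generators serve. -/
theorem exists_functionField_generators [LocallyOfFiniteType π] (x : X) :
    letI := (constFF π).toAlgebra
    ∃ G : Set (X.presheaf.stalk x), G.Finite ∧ ∀ z : X.functionField,
      ∃ a ∈ Algebra.adjoin K (algebraMap (X.presheaf.stalk x) X.functionField '' G),
      ∃ b ∈ Algebra.adjoin K (algebraMap (X.presheaf.stalk x) X.functionField '' G),
        b ≠ 0 ∧ z = a / b := by
  let _ := (constFF π).toAlgebra
  obtain ⟨_, ⟨U, hU, rfl⟩, hxU, -⟩ :=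
    X.isBasis_affineOpens.exists_subset_of_mem_open (Set.mem_univ x) isOpen_univ
  have hU : IsAffineOpen U := hU
  have : Nonempty U := ⟨⟨x, hxU⟩⟩
  let _ := (constSec π U).toAlgebra
  obtain ⟨⟨G, hG⟩⟩ : Algebra.FiniteType K Γ(X, U) := finiteType_constSec hU
  refine ⟨(X.presheaf.germ U x hxU).hom '' G, G.finite_toSet.image _, fun z => ?_⟩
  let ι : Γ(X, U) →ₐ[K] X.functionField :=
    { (X.germToFunctionField U).hom with
      commutes' := fun c => germ_constSec π U _ _ c }
  have himg : algebraMap (X.presheaf.stalk x) X.functionField ''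
      ((X.presheaf.germ U x hxU).hom '' G) = ι '' G := by
    rw [Set.image_image]
    exact Set.image_congr fun s _ => algebraMap_germ x hxU s
  have hmem (s : Γ(X, U)) : ι s ∈ Algebra.adjoin K (ι '' G) := by
    rw [← AlgHom.map_adjoin, hG]
    exact ⟨s, trivial, rfl⟩
  have := functionField_isFractionRing_of_isAffineOpen X U hU
  obtain ⟨a, b, hb, rfl⟩ := IsFractionRing.div_surjective (A := Γ(X, U)) z
  rw [himg]
  refine ⟨ι a, hmem a, ι b, hmem b, ?_, rfl⟩
  exact IsFractionRing.to_map_ne_zero_of_mem_nonZeroDivisors (K := X.functionField) hb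

/-- The points of `X^an` over the generic point of `X` are dense. -/
theorem dense_generic [LocallyOfFiniteType π] (ξ : An π) :
    ξ ∈ closure {ζ : An π | ζ.pt = genericPoint X} := by
  have hbasis := TopologicalSpace.isTopologicalBasis_of_subbasis
    (rfl : (inferInstance : TopologicalSpace (An π)) = TopologicalSpace.generateFrom _)
  rw [hbasis.mem_closure_iff]
  rintro _ ⟨𝒮, ⟨hfin, hsub⟩, rfl⟩ hξ
  let O := X.presheaf.stalk ξ.pt
  -- Each subbasic neighbourhood imposes a condition on a single germ at the point. For the sets
  -- `U^an` the condition is void, as a non-empty open set contains the generic point.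
  have key : ∀ S ∈ 𝒮, ∃ (o : O) (ε : ℝ), 0 < ε ∧
      ∀ (b : AbsoluteValue X.functionField ℝ) (hb : ∀ c : K, c ≠ 0 → b (constFF π c) = 1),
        |b (algebraMap O X.functionField o) - ξ.abv (X.residue ξ.pt o)| < ε →
          genericPointAn π b hb ∈ S := by
    intro S hS
    have hξS : ξ ∈ S := hξ S hS
    rcases hsub hS with ⟨U, rfl⟩ | ⟨U, s, V, hV, rfl⟩
    · exact ⟨0, 1, one_pos, fun b hb _ => genericPoint_mem ⟨_, hξS⟩⟩
    · obtain ⟨hU, hsV⟩ := hξS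
      obtain ⟨ε, hε, hball⟩ := Metric.isOpen_iff.mp hV _ hsV
      refine ⟨X.presheaf.germ U ξ.pt hU s, ε, hε, fun b hb h => ?_⟩
      have hU' : (genericPointAn π b hb).pt ∈ U := genericPoint_mem ⟨_, hU⟩
      refine ⟨hU', hball ?_⟩
      rw [evaluation_genericPointAn, Metric.mem_ball, Real.dist_eq]
      rwa [algebraMap_germ] at h
  choose! o ε hε h using key
  obtain ⟨ε₀, hε₀, hle⟩ : ∃ ε₀ > 0, ∀ S ∈ 𝒮, ε₀ ≤ ε S := by
    rcases 𝒮.eq_empty_or_nonempty with rfl | hne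
    · exact ⟨1, one_pos, by simp⟩
    · obtain ⟨S, hS, hmin⟩ := hfin.exists_minimalFor ε 𝒮 hne
      refine ⟨ε S, hε S hS, fun S' hS' => ?_⟩
      rcases le_total (ε S) (ε S') with h' | h'
      · exact h'
      · exact hmin hS' h'
  let _ := (constFF π).toAlgebra
  obtain ⟨G, hG, hgen⟩ := exists_functionField_generators (π := π) ξ.pt
  have hsub' : algebraMap O X.functionField '' G ⊆ algebraMap O X.functionField '' (G ∪ o '' 𝒮) :=
    Set.image_mono Set.subset_union_left
  obtain ⟨b, hb, hb'⟩ := exists_abv_near (K := K) (F := X.functionField)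
    (IsFractionRing.injective O X.functionField) (X.residue ξ.pt).hom
    (fun r hr => by
      by_contra hu
      exact hr ((IsLocalRing.residue_eq_zero_iff r).mpr hu))
    ξ.abv ξ.abv_add_le_max
    (fun c => ⟨X.presheaf.germ ⊤ ξ.pt trivial (constSec π ⊤ c),
      algebraMap_germ _ _ _, by
        exact (congrArg ξ.abv (evaluation_constSec π ⊤ ξ.pt trivial c)).trans_le
          (ξ.constMap_mem c)⟩)
    (G ∪ o '' 𝒮) (hG.union (hfin.image _))
    (fun x => by
      obtain ⟨y, hy, z, hz, hyz⟩ := hgen x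
      exact ⟨y, Algebra.adjoin_mono hsub' hy, z, Algebra.adjoin_mono hsub' hz, hyz⟩) hε₀
  refine ⟨genericPointAn π b hb, fun S hS => h S hS b hb ?_, rfl⟩
  exact (hb' _ (Or.inr ⟨S, hS, rfl⟩)).trans_le (hle S hS)

/-- Equality of germs gives equality at all points over the generic point, since every non-empty
open set contains it; density and continuity do the rest. -/
theorem eqOn_of_germ_eq [LocallyOfFiniteType π] {U : X.Opens} {θ θ' : An π → ℝ}
    (hθ : ContinuousOn θ (anSet π U)) (hθ' : ContinuousOn θ' (anSet π U))
    (h : (θ : GFun π) = θ') : Set.EqOn θ θ' (anSet π U) := by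
  intro ξ hξ
  obtain ⟨W, hW, hWθ⟩ := (mem_genericFilter π _).mp (Filter.Germ.coe_eq.mp h)
  have hcl := dense_generic ξ
  rw [mem_closure_iff_nhdsWithin_neBot] at hcl
  have hnhds := (isOpen_anSet U).mem_nhds hξ
  have h1 := (hθ.continuousAt hnhds).tendsto.mono_left (nhdsWithin_le_nhds
    (s := {ζ : An π | ζ.pt = genericPoint X}))
  have h2 := (hθ'.continuousAt hnhds).tendsto.mono_left (nhdsWithin_le_nhds
    (s := {ζ : An π | ζ.pt = genericPoint X}))
  refine tendsto_nhds_unique_of_eventuallyEq h1 h2 ?_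
  filter_upwards [self_mem_nhdsWithin] with ζ hζ
  refine hWθ ?_
  change ζ.pt ∈ W
  rw [show ζ.pt = genericPoint X from hζ]
  exact genericPoint_mem hW

end Density

end

end TrivArakelov

namespace TrivArakelov

noncomputable section

/-! ### Reduction points -/

section SpecSections

variable {X : Scheme.{u}}

/-- The pullback of sections over `U` along a morphism `Spec R ⟶ X` with image in `U`. -/
def specSections {R : CommRingCat.{u}} (g : Spec R ⟶ X) (U : X.Opens) (e : ⊤ ≤ g ⁻¹ᵁ U) :
    Γ(X, U) ⟶ R :=
  g.appLE U ⊤ e ≫ (Scheme.ΓSpecIso R).hom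

theorem specSections_comp {R S : CommRingCat.{u}} (g : Spec R ⟶ X) (φ : R ⟶ S) (U : X.Opens)
    (e : ⊤ ≤ g ⁻¹ᵁ U) (e' : ⊤ ≤ (Spec.map φ ≫ g) ⁻¹ᵁ U) :
    specSections (Spec.map φ ≫ g) U e' = specSections g U e ≫ φ := by
  have h : (Spec.map φ ≫ g).appLE U ⊤ e' =
      g.appLE U ⊤ e ≫ (Spec.map φ).appTop :=
    (Scheme.Hom.appLE_comp_appLE (Spec.map φ) g U ⊤ ⊤ e le_rfl).symm.trans
      (congrArg (g.appLE U ⊤ e ≫ ·) (Scheme.Hom.appLE_eq_app _))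
  rw [specSections, specSections, h, Category.assoc, Category.assoc, Scheme.ΓSpecIso_naturality]

theorem specSections_fromSpecStalk (x : X) (U : X.Opens) (hx : x ∈ U)
    (e : ⊤ ≤ (X.fromSpecStalk x) ⁻¹ᵁ U) :
    specSections (X.fromSpecStalk x) U e = X.presheaf.germ U x hx := by
  rw [specSections, Scheme.Hom.appLE, Scheme.fromSpecStalk_app hx, Category.assoc, Category.assoc,
    Category.assoc, ← Functor.map_comp_assoc]
  have : (homOfLE (le_top (a := X.fromSpecStalk x ⁻¹ᵁ U))).op ≫ (homOfLE e).op = 𝟙 _ := rfl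
  rw [this, CategoryTheory.Functor.map_id, Category.id_comp, Iso.inv_hom_id, Category.comp_id]

theorem specSections_fromSpecResidueField (x : X) (U : X.Opens) (hx : x ∈ U)
    (e : ⊤ ≤ (X.fromSpecResidueField x) ⁻¹ᵁ U) :
    specSections (X.fromSpecResidueField x) U e = X.evaluation U x hx := by
  have e' : ⊤ ≤ (X.fromSpecStalk x) ⁻¹ᵁ U := by
    intro y _
    have : X.fromSpecStalk x y ∈ Set.range (X.fromSpecStalk x) := ⟨y, rfl⟩
    rw [Scheme.range_fromSpecStalk] at this
    have hy : X.fromSpecStalk x y ∈ U := Specializes.mem_open this U.isOpen hx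
    exact hy
  rw [← Scheme.germ_residue, ← specSections_fromSpecStalk x U hx e']
  exact specSections_comp _ _ _ _ _

theorem specSections_fromSpec {U : X.Opens} (hU : IsAffineOpen U) (e : ⊤ ≤ hU.fromSpec ⁻¹ᵁ U) :
    specSections hU.fromSpec U e = 𝟙 _ := by
  rw [specSections, Scheme.Hom.appLE, hU.fromSpec_app_self, Category.assoc, Category.assoc,
    ← Functor.map_comp_assoc]
  have : (eqToHom hU.fromSpec_preimage_self).op ≫ (homOfLE e).op = 𝟙 _ := rfl
  rw [this, CategoryTheory.Functor.map_id, Category.id_comp, Iso.inv_hom_id]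

end SpecSections

section Reduction

variable {K : Type u} [Field K] {X : Scheme.{u}} {π : X ⟶ Spec (.of K)}

/-- The homomorphism `𝔬_{f(ξ)} → 𝔬_ξ`. -/
def valuationRingMap (f : X ⟶ X) (hf : f ≫ π = π) (ξ : An π) :
    (anMap f hf ξ).valuationRing →+* ξ.valuationRing :=
  ((f.residueFieldMap ξ.pt).hom.comp
    (anMap f hf ξ).valuationRing.subtype).codRestrict ξ.valuationRing.toSubring fun a => a.2

/-- Units of a valuation ring `𝔬_ξ` are the elements of absolute value one, and the absolute value
of `f^an(ξ)` is by definition the restriction of that of `ξ`. -/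
theorem isLocalHom_valuationRingMap (f : X ⟶ X) (hf : f ≫ π = π) (ξ : An π) :
    IsLocalHom (valuationRingMap f hf ξ) := by
  refine ⟨fun a ha => ?_⟩
  obtain ⟨b, hb⟩ := ha.exists_right_inv
  have hb' : f.residueFieldMap ξ.pt a.1 * b.1 = 1 := congrArg Subtype.val hb
  have key : ∀ x y : ℝ, x * y = 1 → x ≤ 1 → 0 ≤ y → y ≤ 1 → x = 1 :=
    fun x y h1 h2 h3 h4 => by
      have h : y = 1 := le_antisymm h4 (by nlinarith)
      rwa [h, mul_one] at h1
  have h5 : (anMap f hf ξ).abv a.1 = 1 := by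
    refine key _ (ξ.abv b.1) ?_ a.2 (ξ.abv.nonneg _) b.2
    change ξ.abv (f.residueFieldMap ξ.pt a.1) * ξ.abv b.1 = 1
    rw [← map_mul, hb', map_one]
  have h6 : (anMap f hf ξ).abv a.1⁻¹ ≤ 1 := by
    rw [map_inv₀, h5, inv_one]
  have h7 : a.1 ≠ 0 := fun h0 => by
    rw [h0, map_zero] at h5
    exact zero_ne_one h5
  exact IsUnit.of_mul_eq_one ⟨a.1⁻¹, h6⟩ (Subtype.ext (mul_inv_cancel₀ h7))

variable [IsProper π]

theorem An.extension_spec (ξ : An π) :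
    Spec.map (CommRingCat.ofHom (algebraMap ξ.valuationRing (X.residueField ξ.pt))) ≫ ξ.extension =
      X.fromSpecResidueField ξ.pt :=
  ξ.exists_extension.choose_spec

theorem An.extension_preimage (ξ : An π) {U : X.Opens} (h : ξ.reduction ∈ U) :
    ⊤ ≤ ξ.extension ⁻¹ᵁ U := by
  have h1 : IsLocalRing.closedPoint ξ.valuationRing ∈ ξ.extension ⁻¹ᵁ U := h
  exact ((IsLocalRing.closedPoint_mem_iff _).mp h1).ge

theorem An.pt_mem_of_reduction_mem (ξ : An π) {U : X.Opens} (h : ξ.reduction ∈ U) : ξ.pt ∈ U := by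
  obtain ⟨s⟩ : Nonempty (Spec (X.residueField ξ.pt)) := inferInstance
  rw [← X.fromSpecResidueField_apply ξ.pt s, ← ξ.extension_spec]
  exact ξ.extension_preimage h trivial

/-- Since the closed point of `Spec 𝔬_ξ` lands in `U`, all of `Spec 𝔬_ξ` does; hence evaluation of
sections over `U` at `ξ` factors through `𝔬_ξ`. -/
theorem An.abv_evaluation_le_one (ξ : An π) {U : X.Opens} (h : ξ.reduction ∈ U) (s : Γ(X, U)) :
    ξ.abv (X.evaluation U ξ.pt (ξ.pt_mem_of_reduction_mem h) s) ≤ 1 := by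
  have e' : ⊤ ≤ (X.fromSpecResidueField ξ.pt) ⁻¹ᵁ U := fun y _ => by
    change X.fromSpecResidueField ξ.pt y ∈ U
    rw [X.fromSpecResidueField_apply]
    exact ξ.pt_mem_of_reduction_mem h
  have h1 : X.evaluation U ξ.pt (ξ.pt_mem_of_reduction_mem h) =
      specSections ξ.extension U (ξ.extension_preimage h) ≫
        CommRingCat.ofHom (algebraMap ξ.valuationRing (X.residueField ξ.pt)) := by
    rw [← specSections_fromSpecResidueField _ _ _ e',
      ← specSections_comp _ _ _ _ (by rw [ξ.extension_spec]; exact e')]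
    congr 1
    exact ξ.extension_spec.symm
  have h2 := congr($(h1).hom s)
  change ξ.abv ((X.evaluation U ξ.pt (ξ.pt_mem_of_reduction_mem h)).hom s) ≤ 1
  rw [h2]
  exact (specSections ξ.extension U (ξ.extension_preimage h) s).2

/-- As `𝔬_ξ → κ(ξ)` is injective, the two morphisms agree over `Spec K` and `Spec κ(ξ)` is dense in
the reduced scheme `Spec 𝔬_ξ`; separatedness concludes. -/
theorem An.extension_unique (ξ : An π) {r r' : Spec (.of ξ.valuationRing) ⟶ X}
    (h : Spec.map (CommRingCat.ofHom (algebraMap ξ.valuationRing (X.residueField ξ.pt))) ≫ r =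
      Spec.map (CommRingCat.ofHom (algebraMap ξ.valuationRing (X.residueField ξ.pt))) ≫ r') :
    r = r' := by
  have hs : r ≫ π = r' ≫ π := by
    obtain ⟨φ, hφ⟩ := Spec.map_surjective (r ≫ π)
    obtain ⟨ψ, hψ⟩ := Spec.map_surjective (r' ≫ π)
    rw [← hφ, ← hψ]
    congr 1
    have h1 := congrArg (· ≫ π) h
    simp only [Category.assoc, ← hφ, ← hψ, ← Spec.map_comp] at h1
    have h2 := Spec.map_injective h1
    ext c
    exact Subtype.ext_iff.mp (IsFractionRing.injective ξ.valuationRing (X.residueField ξ.pt)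
      congr($(h2).hom c))
  have : IsDominant
      (Spec.map (CommRingCat.ofHom (algebraMap ξ.valuationRing (X.residueField ξ.pt)))) := by
    refine ⟨(PrimeSpectrum.denseRange_comap_iff_ker_le_nilRadical _).mpr ?_⟩
    exact ((RingHom.injective_iff_ker_eq_bot _).mp
      (IsFractionRing.injective ξ.valuationRing (X.residueField ξ.pt))).le.trans bot_le
  exact ext_of_isDominant_of_isSeparated π hs _ h

/-- Both composites `Spec 𝔬_ξ → X` extend the same map from `Spec κ(ξ)`, so they coincide; locality
of `𝔬_{f(ξ)} → 𝔬_ξ` lets closed points be compared. -/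
theorem reduction_anMap (f : X ⟶ X) (hf : f ≫ π = π) (ξ : An π) :
    (anMap f hf ξ).reduction = f ξ.reduction := by
  have h : Spec.map (CommRingCat.ofHom (valuationRingMap f hf ξ)) ≫ (anMap f hf ξ).extension =
      ξ.extension ≫ f := by
    refine ξ.extension_unique ?_
    let ρ : CommRingCat.of (X.residueField (anMap f hf ξ).pt) ⟶
      CommRingCat.of (X.residueField ξ.pt) := f.residueFieldMap ξ.pt
    have h1 : CommRingCat.ofHom (valuationRingMap f hf ξ) ≫
        CommRingCat.ofHom (algebraMap ξ.valuationRing (X.residueField ξ.pt)) =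
        CommRingCat.ofHom (algebraMap (anMap f hf ξ).valuationRing
          (X.residueField (anMap f hf ξ).pt)) ≫ ρ := rfl
    rw [← Category.assoc, ← Category.assoc, ← Spec.map_comp, h1, Spec.map_comp, Category.assoc]
    refine (congrArg (Spec.map ρ ≫ ·) (anMap f hf ξ).extension_spec).trans ?_
    refine (Scheme.Hom.SpecMap_residueFieldMap_fromSpecResidueField f ξ.pt).trans ?_
    exact congrArg (· ≫ f) ξ.extension_spec.symm
  have := isLocalHom_valuationRingMap f hf ξ
  have h2 : Spec.map (CommRingCat.ofHom (valuationRingMap f hf ξ))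
      (IsLocalRing.closedPoint ξ.valuationRing) =
        IsLocalRing.closedPoint (anMap f hf ξ).valuationRing :=
    IsLocalRing.comap_closedPoint (valuationRingMap f hf ξ)
  exact (congrArg (anMap f hf ξ).extension h2.symm).trans
    (congrArg (fun g : Spec (.of ξ.valuationRing) ⟶ X => g (IsLocalRing.closedPoint ξ.valuationRing)) h)

end Reduction

end

end TrivArakelov

namespace TrivArakelov

noncomputable section

/-! ### Compactness of Berkovich spaces -/

section Compactness

variable {K : Type u} [Field K] {X : Scheme.{u}} {π : X ⟶ Spec (.of K)}

theorem evalAbs_mul {U : X.Opens} (a b : Γ(X, U)) (ξ : An π) :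
    evalAbs (a * b) ξ = evalAbs a ξ * evalAbs b ξ := by
  by_cases h : ξ.pt ∈ U
  · simp only [evalAbs_of_mem _ ξ h, map_mul]
  · simp [evalAbs, h]

theorem evalAbs_nonneg {U : X.Opens} (a : Γ(X, U)) (ξ : An π) : 0 ≤ evalAbs a ξ := by
  by_cases h : ξ.pt ∈ U
  · rw [evalAbs_of_mem _ ξ h]; exact ξ.abv.nonneg _
  · simp [evalAbs, h]

theorem evalAbs_add_le {U : X.Opens} (a b : Γ(X, U)) (ξ : An π) :
    evalAbs (a + b) ξ ≤ max (evalAbs a ξ) (evalAbs b ξ) := by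
  by_cases h : ξ.pt ∈ U
  · simp only [evalAbs_of_mem _ ξ h, map_add]; exact ξ.abv_add_le_max _ _
  · simp [evalAbs, h]

theorem evalAbs_zero {U : X.Opens} (ξ : An π) : evalAbs (0 : Γ(X, U)) ξ = 0 := by
  by_cases h : ξ.pt ∈ U
  · rw [evalAbs_of_mem _ ξ h, map_zero, map_zero]
  · simp [evalAbs, h]

theorem evalAbs_constSec {U : X.Opens} (c : K) (hc : c ≠ 0) (ξ : An π) (h : ξ.pt ∈ U) :
    evalAbs (constSec π U c) ξ = 1 := by
  rw [evalAbs_of_mem _ ξ h, evaluation_constSec, ξ.abv_const c hc]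

theorem evalAbs_res {U V : X.Opens} (i : V ≤ U) (s : Γ(X, U)) (ξ : An π) (h : ξ.pt ∈ V) :
    evalAbs (X.presheaf.map (homOfLE i).op s) ξ = evalAbs s ξ := by
  rw [evalAbs_of_mem _ ξ h, evalAbs_of_mem _ ξ (i h)]
  exact congrArg (fun z => ξ.abv (X.residue ξ.pt z)) (X.presheaf.germ_res_apply (homOfLE i) ξ.pt h s)

theorem evalAbs_ne_zero_iff {U : X.Opens} (s : Γ(X, U)) (ξ : An π) :
    evalAbs s ξ ≠ 0 ↔ ξ.pt ∈ X.basicOpen s := by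
  by_cases h : ξ.pt ∈ U
  · rw [evalAbs_of_mem _ ξ h, ← X.evaluation_ne_zero_iff_mem_basicOpen ξ.pt h, ne_eq,
      map_eq_zero]
  · have h' : ξ.pt ∉ X.basicOpen s := fun h' => h (X.basicOpen_le s h')
    simp [evalAbs, h, h']

/-- A multiplicative seminorm on a ring is induced by an absolute value on a field. -/
theorem exists_field_of_valuation {A : Type u} [CommRing A] (v : Valuation A NNReal) :
    ∃ (L : Type u) (_ : Field L) (ψ : A →+* L) (b : AbsoluteValue L ℝ), ∀ a, b (ψ a) = v a := by
  let w : Valuation (A ⧸ v.supp) NNReal := v.onQuot le_rfl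
  have hw : nonZeroDivisors (A ⧸ v.supp) ≤ w.supp.primeCompl := by
    intro x hx hx'
    have h0 : w.supp = 0 := v.supp_quot_supp
    rw [SetLike.mem_coe, h0] at hx'
    exact nonZeroDivisors.ne_zero hx hx'
  let z : Valuation (FractionRing (A ⧸ v.supp)) NNReal :=
    w.extendToLocalization hw (FractionRing (A ⧸ v.supp))
  refine ⟨FractionRing (A ⧸ v.supp), inferInstance,
    (algebraMap (A ⧸ v.supp) (FractionRing (A ⧸ v.supp))).comp (Ideal.Quotient.mk v.supp),
    ⟨⟨fun x => z x, fun x y => by rw [map_mul, NNReal.coe_mul]⟩, fun x => (z x).2, fun x => ?_,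
      fun x y => ?_⟩, fun a => ?_⟩
  · change ((z x : NNReal) : ℝ) = 0 ↔ _
    rw [NNReal.coe_eq_zero, z.zero_iff]
  · change ((z (x + y) : NNReal) : ℝ) ≤ z x + z y
    exact_mod_cast (z.map_add x y).trans (max_le_add_of_nonneg zero_le zero_le)
  · change ((z (algebraMap _ _ (Ideal.Quotient.mk v.supp a)) : NNReal) : ℝ) = v a
    rw [Valuation.extendToLocalization_apply_map_apply]
    rfl

/-- A multiplicative seminorm on the sections over an affine open set that is trivial on constants is
given by a point of the Berkovich space. -/
theorem exists_an_of_valuation {U : X.Opens} (hU : IsAffineOpen U) (v : Valuation Γ(X, U) NNReal)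
    (hv : ∀ c : K, c ≠ 0 → v (constSec π U c) = 1) :
    ∃ ξ : An π, ξ.pt ∈ U ∧ ∀ a, evalAbs a ξ = v a := by
  obtain ⟨L, _, ψ, b, hb⟩ := exists_field_of_valuation v
  let q : Spec (.of L) ⟶ X := Spec.map (CommRingCat.ofHom ψ) ≫ hU.fromSpec
  -- The scheme point is the image of `Spec L`; its residue field embeds in `L`, from which the
  -- absolute value is restricted.
  let x : X := q (IsLocalRing.closedPoint L)
  let δ : X.residueField x ⟶ .of L := Scheme.descResidueField (Scheme.stalkClosedPointTo q)
  have hδ : Spec.map δ ≫ X.fromSpecResidueField x = q :=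
    Scheme.descResidueField_stalkClosedPointTo_fromSpecResidueField L X q
  have hx : x ∈ U := by
    have : x ∈ Set.range hU.fromSpec :=
      ⟨Spec.map (CommRingCat.ofHom ψ) (IsLocalRing.closedPoint L), rfl⟩
    rwa [hU.range_fromSpec] at this
  have e1 : ⊤ ≤ (X.fromSpecResidueField x) ⁻¹ᵁ U := fun y _ => by
    change X.fromSpecResidueField x y ∈ U
    rwa [X.fromSpecResidueField_apply]
  have e2 : ⊤ ≤ hU.fromSpec ⁻¹ᵁ U := hU.fromSpec_preimage_self.ge
  have e3 : ⊤ ≤ q ⁻¹ᵁ U := fun y _ => e2 (x := Spec.map (CommRingCat.ofHom ψ) y) trivial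
  have h1 : X.evaluation U x hx ≫ δ = CommRingCat.ofHom ψ := by
    have h2 : specSections q U e3 = CommRingCat.ofHom ψ := by
      rw [specSections_comp hU.fromSpec (CommRingCat.ofHom ψ) U e2 e3, specSections_fromSpec hU,
        Category.id_comp]
    rw [← specSections_fromSpecResidueField x U hx e1, ← h2,
      ← specSections_comp _ _ _ _ (by rw [hδ]; exact e3)]
    congr 1
  have h3 (a : Γ(X, U)) : δ.hom (X.evaluation U x hx a) = ψ a := congr($(h1).hom a)
  refine ⟨⟨x, b.comp (f := δ.hom) (RingHom.injective _), fun c hc => ?_⟩, hx, fun a => ?_⟩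
  · rw [← evaluation_constSec π U x hx c]
    change b (δ.hom (X.evaluation U x hx (constSec π U c))) = 1
    rw [h3, hb, hv c hc, NNReal.coe_one]
  · rw [evalAbs_of_mem _ _ hx, ← hb, ← h3]
    rfl

/-- Convergence in `X^an` to a point of an affine open set can be tested on regular functions. -/
theorem le_nhds_of_tendsto {U : X.Opens} (hU : IsAffineOpen U) (𝓕 : Filter (An π)) (ξ : An π)
    (hξ : ξ.pt ∈ U)
    (h : ∀ a : Γ(X, U), Filter.Tendsto (evalAbs a) 𝓕 (𝓝 (evalAbs a ξ))) : 𝓕 ≤ 𝓝 ξ := by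
  have hbasic (b : Γ(X, U)) (hb : ξ.pt ∈ X.basicOpen b) : ∀ᶠ ζ in 𝓕, ζ.pt ∈ X.basicOpen b := by
    have := (h b).eventually_ne ((evalAbs_ne_zero_iff b ξ).mpr hb)
    exact this.mono fun ζ hζ => (evalAbs_ne_zero_iff b ζ).mp hζ
  change Filter.Tendsto id 𝓕 (𝓝 ξ)
  refine TopologicalSpace.tendsto_nhds_generateFrom_iff.mpr ?_
  rintro S (⟨W, rfl⟩ | ⟨W, s, V, hV, rfl⟩) hξS
  · obtain ⟨b, hbW, hb⟩ := hU.exists_basicOpen_le ⟨ξ.pt, hξS⟩ hξ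
    exact (hbasic b hb).mono fun ζ hζ => hbW hζ
  · obtain ⟨hW, hsV⟩ := hξS
    obtain ⟨b, hbW, hb⟩ := hU.exists_basicOpen_le ⟨ξ.pt, hW⟩ hξ
    have hloc := hU.isLocalization_basicOpen b
    -- Near the point, `s` equals `a / b ^ n` with `a`, `b` regular on all of `U`, so the
    -- convergence of `|s|` follows from that of `|a|` and `|b|`.
    obtain ⟨n, a, ha⟩ := IsLocalization.Away.surj b (X.presheaf.map (homOfLE hbW).op s)
    have key (ζ : An π) (hζ : ζ.pt ∈ X.basicOpen b) :
        evalAbs s ζ = evalAbs a ζ / evalAbs b ζ ^ n := by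
      have hb0 : evalAbs b ζ ≠ 0 := (evalAbs_ne_zero_iff b ζ).mpr hζ
      rw [eq_div_iff (pow_ne_zero _ hb0)]
      have h1 := congrArg (fun z => evalAbs (π := π) z ζ) ha
      have hpow : ∀ (m : ℕ) (z : Γ(X, X.basicOpen b)),
          evalAbs (z ^ m) ζ = evalAbs z ζ ^ m := by
        intro m z
        simp only [evalAbs_of_mem _ ζ hζ, map_pow]
      dsimp only at h1
      rw [evalAbs_mul, hpow, evalAbs_res hbW s ζ hζ] at h1
      have h2 (z : Γ(X, U)) : evalAbs (algebraMap Γ(X, U) Γ(X, X.basicOpen b) z) ζ =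
          evalAbs z ζ := evalAbs_res (X.basicOpen_le b) z ζ hζ
      rwa [h2, h2] at h1
    have hlim : Filter.Tendsto (evalAbs s) 𝓕 (𝓝 (evalAbs s ξ)) := by
      rw [key ξ hb]
      refine Filter.Tendsto.congr' ((hbasic b hb).mono fun ζ hζ => (key ζ hζ).symm) ?_
      exact (h a).div ((h b).pow n) (pow_ne_zero _ ((evalAbs_ne_zero_iff b ξ).mpr hb))
    have hsV' : evalAbs s ξ ∈ V := by rwa [evalAbs_of_mem _ ξ hW]
    filter_upwards [hbasic b hb, hlim.eventually (hV.mem_nhds hsV')] with ζ h1 h2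
    refine ⟨hbW h1, ?_⟩
    rwa [evalAbs_of_mem _ ζ (hbW h1)] at h2

/-- The set of points at which the regular functions on `U` are bounded by one. -/
def unitDomain (π : X ⟶ Spec (.of K)) (U : X.Opens) : Set (An π) :=
  {ξ | ξ.pt ∈ U ∧ ∀ a : Γ(X, U), evalAbs a ξ ≤ 1}

/-- Along an ultrafilter every `|a|`, being confined to `[0, 1]`, has a limit. These limits form a
multiplicative ultrametric seminorm trivial on constants, that is, a point of the same set, and the
ultrafilter converges to it. -/
theorem isCompact_unitDomain {U : X.Opens} (hU : IsAffineOpen U) : IsCompact (unitDomain π U) := by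
  rw [isCompact_iff_ultrafilter_le_nhds']
  intro 𝓕 h𝓕
  have hmem : ∀ᶠ ζ : An π in (𝓕 : Filter (An π)), ζ.pt ∈ U :=
    Filter.mem_of_superset h𝓕 fun ζ hζ => hζ.1
  have hlim (a : Γ(X, U)) : ∃ r ∈ Set.Icc (0 : ℝ) 1,
      Filter.Tendsto (evalAbs a) (𝓕 : Filter (An π)) (𝓝 r) := by
    refine isCompact_Icc.ultrafilter_le_nhds' (𝓕.map (evalAbs a)) ?_
    refine Ultrafilter.mem_map.mpr (Filter.mem_of_superset h𝓕 ?_)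
    exact fun ζ hζ => ⟨evalAbs_nonneg a ζ, hζ.2 a⟩
  choose N hN hNlim using hlim
  let v : Valuation Γ(X, U) NNReal :=
    { toFun := fun a => ⟨N a, (hN a).1⟩
      map_zero' := NNReal.eq <| tendsto_nhds_unique (hNlim 0)
        (tendsto_const_nhds.congr fun ζ => (evalAbs_zero ζ).symm)
      map_one' := NNReal.eq <| tendsto_nhds_unique (hNlim 1)
        (tendsto_const_nhds.congr' (hmem.mono fun ζ hζ => by
          rw [evalAbs_of_mem _ ζ hζ, map_one, map_one]; rfl))
      map_mul' := fun a b => NNReal.eq <| tendsto_nhds_unique (hNlim (a * b))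
        (((hNlim a).mul (hNlim b)).congr fun ζ => (evalAbs_mul a b ζ).symm)
      map_add_le_max' := fun a b => by
        have := le_of_tendsto_of_tendsto' (hNlim (a + b)) ((hNlim a).max (hNlim b))
          fun ζ => evalAbs_add_le a b ζ
        exact this }
  obtain ⟨ξ, hξ, hv⟩ := exists_an_of_valuation (π := π) hU v fun c hc => NNReal.eq <|
    tendsto_nhds_unique (hNlim _) (tendsto_const_nhds.congr' (hmem.mono fun ζ hζ =>
      (evalAbs_constSec c hc ζ hζ).symm))
  refine ⟨ξ, ⟨hξ, fun a => (hv a).trans_le (hN a).2⟩, ?_⟩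
  refine le_nhds_of_tendsto hU _ ξ hξ fun a => ?_
  rw [hv a]
  exact hNlim a

theorem mem_unitDomain_of_reduction [IsProper π] (ξ : An π) {U : X.Opens} (h : ξ.reduction ∈ U) :
    ξ ∈ unitDomain π U :=
  ⟨ξ.pt_mem_of_reduction_mem h, fun a => by
    rw [evalAbs_of_mem _ ξ (ξ.pt_mem_of_reduction_mem h)]
    exact ξ.abv_evaluation_le_one h a⟩

theorem compactSpace_of_isProper (π : X ⟶ Spec (.of K)) [IsProper π] : CompactSpace X :=
  QuasiCompact.compactSpace_of_compactSpace π

/-- Every `ξ` lies in the unit domain of any affine open set containing its reduction point, so a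
finite affine cover of `X` gives a finite cover of `X^an` by compact sets. -/
instance compactSpace_an [IsProper π] : CompactSpace (An π) := by
  have := compactSpace_of_isProper π
  have hU (x : X) : ∃ U : X.Opens, IsAffineOpen U ∧ x ∈ U := by
    obtain ⟨_, ⟨U, hU, rfl⟩, hxU, -⟩ :=
      X.isBasis_affineOpens.exists_subset_of_mem_open (Set.mem_univ x) isOpen_univ
    exact ⟨U, hU, hxU⟩
  choose U hU hxU using hU
  obtain ⟨t, ht⟩ := isCompact_univ.elim_finite_subcover (fun x => (U x : Set X))
    (fun x => (U x).isOpen) fun x _ => Set.mem_iUnion.mpr ⟨x, hxU x⟩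
  refine ⟨?_⟩
  have : (Set.univ : Set (An π)) = ⋃ x ∈ t, unitDomain π (U x) := by
    refine (Set.eq_univ_of_forall fun ξ => ?_).symm
    obtain ⟨x, hx, hx'⟩ := Set.mem_iUnion₂.mp (ht (Set.mem_univ ξ.reduction))
    exact Set.mem_iUnion₂.mpr ⟨x, hx, mem_unitDomain_of_reduction ξ hx'⟩
  rw [this]
  exact t.isCompact_biUnion fun x _ => isCompact_unitDomain (hU x)

end Compactness

end

end TrivArakelov

namespace TrivArakelov

noncomputable section

/-! ### Local equations -/

section MapR

theorem mapR_tmul {G H : Type u} [CommGroup G] [CommGroup H] (φ : G →* H) (r : ℝ) (a : Additive G) :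
    mapR φ (r ⊗ₜ[ℤ] a) = r ⊗ₜ[ℤ] Additive.ofMul (φ a.toMul) :=
  LinearMap.baseChange_tmul _ _ _

theorem mapR_mapR {G H J : Type u} [CommGroup G] [CommGroup H] [CommGroup J] (φ : G →* H)
    (ψ : H →* J) (z : ℝ ⊗[ℤ] Additive G) : mapR ψ (mapR φ z) = mapR (ψ.comp φ) z := by
  induction z with
  | zero => simp only [map_zero]
  | tmul r a => simp only [mapR_tmul]; rfl
  | add x y hx hy => simp only [map_add, hx, hy]

/-- Right exactness of the tensor product: the kernel of `G ⊗ ℝ → H ⊗ ℝ` is the image of `ker φ ⊗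
ℝ`. It reduces statements about real combinations of units to honest units. -/
theorem mem_span_of_mapR_eq_zero {G H : Type u} [CommGroup G] [CommGroup H] (φ : G →* H)
    (hφ : Function.Surjective φ) (z : ℝ ⊗[ℤ] Additive G) (hz : mapR φ z = 0) :
    z ∈ Submodule.span ℝ
      {w : ℝ ⊗[ℤ] Additive G | ∃ u ∈ φ.ker, w = 1 ⊗ₜ[ℤ] Additive.ofMul u} := by
  let i : Additive φ.ker →ₗ[ℤ] Additive G := (MonoidHom.toAdditive φ.ker.subtype).toIntLinearMap
  let p : Additive G →ₗ[ℤ] Additive H := (MonoidHom.toAdditive φ).toIntLinearMap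
  have hex : Function.Exact i p := by
    intro a
    constructor
    · intro ha
      exact ⟨Additive.ofMul ⟨a.toMul, ha⟩, rfl⟩
    · rintro ⟨b, rfl⟩
      exact b.toMul.2
  obtain ⟨y, rfl⟩ := (lTensor_exact ℝ hex hφ z).mp hz
  induction y with
  | zero => rw [map_zero]; exact Submodule.zero_mem _
  | tmul r a =>
    have : (LinearMap.lTensor ℝ i) (r ⊗ₜ[ℤ] a) =
        r • ((1 : ℝ) ⊗ₜ[ℤ] Additive.ofMul (a.toMul : G)) := by
      rw [LinearMap.lTensor_tmul, TensorProduct.smul_tmul', smul_eq_mul, mul_one]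
      rfl
    rw [this]
    exact Submodule.smul_mem _ _ (Submodule.subset_span ⟨_, a.toMul.2, rfl⟩)
  | add x y hx hy =>
    rw [map_add] at hz ⊢
    refine Submodule.add_mem _ (hx ?_) (hy ?_)
    · exact (lTensor_exact ℝ hex hφ _).mpr ⟨x, rfl⟩
    · exact (lTensor_exact ℝ hex hφ _).mpr ⟨y, rfl⟩

end MapR

section LocalEquation

variable {X : Scheme.{u}} [IsIntegral X]

theorem IsLocalEquation.mono {D : DivR X} {φ : RatR X} {U V : X.Opens} (h : IsLocalEquation D φ U)
    (hV : V ≤ U) : IsLocalEquation D φ V := fun x hx => h x (hV hx)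

theorem IsLocalEquation.add {D E : DivR X} {φ ψ : RatR X} {U : X.Opens}
    (h : IsLocalEquation D φ U) (h' : IsLocalEquation E ψ U) :
    IsLocalEquation (D + E) (φ + ψ) U := fun x hx => by
  rw [map_add, map_add, h x hx, h' x hx]

theorem IsLocalEquation.smul {D : DivR X} {φ : RatR X} {U : X.Opens}
    (h : IsLocalEquation D φ U) (c : ℝ) : IsLocalEquation (c • D) (c • φ) U := fun x hx => by
  rw [map_smul, map_smul, h x hx]

theorem isLocalEquation_principalR (φ : RatR X) (U : X.Opens) :
    IsLocalEquation (principalR X φ) φ U := fun _ _ => mapR_mapR _ _ _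

theorem isLocalEquation_toR {E : Div X} {φ : (X.functionField)ˣ} {U : X.Opens}
    (h : ∀ y ∈ U, germ X y E = localDiv X y φ) :
    IsLocalEquation E.toR (1 ⊗ₜ[ℤ] Additive.ofMul φ) U := fun x hx => by
  rw [Div.toR, mapR_tmul, mapR_tmul, toMul_ofMul, toMul_ofMul, h x hx]

theorem tmul_eq_smul_toR (r : ℝ) (E : Additive (Div X)) :
    r ⊗ₜ[ℤ] E = r • E.toMul.toR := by
  rw [Div.toR, TensorProduct.smul_tmul', smul_eq_mul, mul_one]
  rfl

theorem exists_isLocalEquation (D : DivR X) (x : X) :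
    ∃ (U : X.Opens) (φ : RatR X), x ∈ U ∧ IsLocalEquation D φ U := by
  induction D using TensorProduct.induction_on with
  | zero => exact ⟨⊤, 0, trivial, fun y _ => by rw [map_zero, map_zero]⟩
  | tmul r E =>
    obtain ⟨U, hxU, φ, hφ⟩ := E.toMul.2 x
    rw [tmul_eq_smul_toR]
    exact ⟨U, _, hxU, (isLocalEquation_toR hφ).smul r⟩
  | add D E hD hE =>
    obtain ⟨U, φ, hxU, hφ⟩ := hD
    obtain ⟨V, ψ, hxV, hψ⟩ := hE
    exact ⟨U ⊓ V, φ + ψ, ⟨hxU, hxV⟩, (hφ.mono inf_le_left).add (hψ.mono inf_le_right)⟩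

end LocalEquation

/-! ### Pullback of local equations, effectivity and germs of functions -/

section PullbackR

variable {X Y : Scheme.{u}} [IsIntegral X] [IsIntegral Y] (f : X ⟶ Y) [IsDominant f]

/-- The pullback of `ℝ`-rational functions. -/
def pullbackRatR : RatR Y →ₗ[ℝ] RatR X := mapR (Units.map (pullbackRat f).toMonoidHom)

theorem IsLocalEquation.pullback {D : DivR Y} {φ : RatR Y} {U : Y.Opens}
    (h : IsLocalEquation D φ U) :
    IsLocalEquation (pullbackDivR f D) (pullbackRatR f φ) (f ⁻¹ᵁ U) := fun x hx => by
  have h1 := congrArg (mapR (pullbackLocalDiv f x)) (h (f x) hx)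
  rw [mapR_mapR, mapR_mapR] at h1
  rw [pullbackDivR, pullbackRatR, mapR_mapR, mapR_mapR]
  exact h1

theorem pullbackDivR_principalR (φ : RatR Y) :
    pullbackDivR f (principalR Y φ) = principalR X (pullbackRatR f φ) := by
  rw [pullbackDivR, pullbackRatR, principalR, principalR, mapR_mapR, mapR_mapR]
  rfl

theorem pullbackDivR_toR (E : Div Y) : pullbackDivR f E.toR = (pullbackDiv f E).toR := by
  rw [pullbackDivR, Div.toR, mapR_tmul]
  rfl

theorem Div.IsEffective.pullback {E : Div Y} (h : E.IsEffective) :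
    (pullbackDiv f E).IsEffective := by
  intro x φ hφ
  obtain ⟨ψ, hψ⟩ := QuotientGroup.mk'_surjective (stalkUnits Y (f x)) (germ Y (f x) E)
  obtain ⟨s, hs⟩ := h (f x) ψ hψ.symm
  have h1 : localDiv X x (Units.map (pullbackRat f).toMonoidHom ψ) = localDiv X x φ := by
    rw [← hφ]
    change _ = pullbackLocalDiv f x (germ Y (f x) E)
    rw [← hψ]
    rfl
  obtain ⟨u, hu⟩ := QuotientGroup.eq.mp h1
  refine ⟨f.stalkMap x s * u, ?_⟩
  have h2 : (φ : X.functionField) = pullbackRat f ψ * algebraMap _ X.functionField (u : X.presheaf.stalk x) := by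
    have := congrArg (fun v : (X.functionField)ˣ =>
      ((Units.map (pullbackRat f).toMonoidHom ψ * v : (X.functionField)ˣ) : X.functionField)) hu
    simp only [mul_inv_cancel_left] at this
    exact this.symm
  rw [map_mul, h2, ← hs, pullbackRat_algebraMap]

theorem IsEffective.pullback {D : DivR Y} (h : IsEffective D) : IsEffective (pullbackDivR f D) := by
  obtain ⟨r, E, a, hE, ha, rfl⟩ := h
  refine ⟨r, fun i => pullbackDiv f (E i), a, fun i => (hE i).pullback f, ha, ?_⟩
  simp only [map_sum, map_smul, pullbackDivR_toR]

theorem IsEffective.smul {D : DivR X} (h : IsEffective D) {c : ℝ} (hc : 0 < c) :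
    IsEffective (c • D) := by
  obtain ⟨r, E, a, hE, ha, rfl⟩ := h
  exact ⟨r, E, fun i => c * a i, hE, fun i => mul_pos hc (ha i), by
    simp only [Finset.smul_sum, mul_smul]⟩

variable {K : Type u} [Field K] {π : X ⟶ Spec (.of K)} {ρ : Y ⟶ Spec (.of K)} (hf : f ≫ ρ = π)

theorem tendsto_anMap : Filter.Tendsto (anMap f hf) (genericFilter π) (genericFilter ρ) := by
  refine Filter.tendsto_comap_iff.mpr ?_
  have h := f.continuous.tendsto (genericPoint X)
  rw [map_genericPoint f] at h
  exact h.comp Filter.tendsto_comap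

theorem pullbackGFun_coe (θ : An ρ → ℝ) :
    pullbackGFun f hf (θ : GFun ρ) = ((θ ∘ anMap f hf : An π → ℝ) : GFun π) := rfl

theorem pullbackGFun_add (g h : GFun ρ) :
    pullbackGFun f hf (g + h) = pullbackGFun f hf g + pullbackGFun f hf h := by
  induction g using Filter.Germ.inductionOn
  induction h using Filter.Germ.inductionOn
  rfl

theorem pullbackGFun_sub (g h : GFun ρ) :
    pullbackGFun f hf (g - h) = pullbackGFun f hf g - pullbackGFun f hf h := by
  induction g using Filter.Germ.inductionOn
  induction h using Filter.Germ.inductionOn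
  rfl

theorem pullbackGFun_smul (c : ℝ) (g : GFun ρ) :
    pullbackGFun f hf (c • g) = c • pullbackGFun f hf g := by
  induction g using Filter.Germ.inductionOn
  rfl

theorem logAbsR_tmul (π : X ⟶ Spec (.of K)) (r : ℝ) (u : Additive (X.functionField)ˣ) :
    logAbsR π (r ⊗ₜ[ℤ] u) = r • logAbs π u := by
  rw [logAbsR, LinearMap.liftBaseChange_tmul]
  rfl

theorem pullbackGFun_logAbs (u : Additive (Y.functionField)ˣ) :
    pullbackGFun f hf (logAbs ρ u) =
      logAbs π (Additive.ofMul (Units.map (pullbackRat f).toMonoidHom u.toMul)) := by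
  refine Filter.Germ.coe_eq.mpr ?_
  filter_upwards [(tendsto_anMap f hf).eventually (eventually_isUnit ρ u.toMul)] with ξ hξ
  obtain ⟨s, hs⟩ : ∃ s : Y.presheaf.stalk (f ξ.pt),
      algebraMap _ Y.functionField s = (u.toMul : Y.functionField) := hξ.imp' Units.val fun _ h => h
  change Real.log (absFun ρ (u.toMul : Y.functionField) (anMap f hf ξ)) =
    Real.log (absFun π (pullbackRat f (u.toMul : Y.functionField)) ξ)
  have h1 : absFun ρ (algebraMap _ Y.functionField s) (anMap f hf ξ) =
      ξ.abv (f.residueFieldMap ξ.pt (Y.residue (f ξ.pt) s)) := absFun_algebraMap ρ (anMap f hf ξ) s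
  rw [← hs, h1, pullbackRat_algebraMap, absFun_algebraMap]
  exact congrArg (fun z => Real.log (ξ.abv z))
    congr($(Scheme.residue_residueFieldMap f ξ.pt).hom s)

theorem pullbackGFun_logAbsR (φ : RatR Y) :
    pullbackGFun f hf (logAbsR ρ φ) = logAbsR π (pullbackRatR f φ) := by
  induction φ using TensorProduct.induction_on with
  | zero => simp only [map_zero]; rfl
  | tmul r u =>
    rw [logAbsR_tmul, pullbackGFun_smul, pullbackGFun_logAbs, pullbackRatR, mapR_tmul, logAbsR_tmul]
  | add x y hx hy => simp only [map_add, pullbackGFun_add, hx, hy]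

end PullbackR

/-! ### Heights -/

section Height

variable {K : Type u} [Field K] {X : Scheme.{u}} [IsIntegral X] {π : X ⟶ Spec (.of K)}

theorem absFun_germ {U : X.Opens} {x : X} (hx : x ∈ U) (s : Γ(X, U)) {φ : X.functionField}
    (hφ : algebraMap (X.presheaf.stalk x) X.functionField (X.presheaf.germ U x hx s) = φ)
    (ξ : An π) (hξ : ξ.pt ∈ U) : absFun π φ ξ = evalAbs s ξ := by
  rw [evalAbs_of_mem _ ξ hξ, ← hφ, algebraMap_germ x hx, ← algebraMap_germ ξ.pt hξ,
    absFun_algebraMap]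
  rfl

theorem exists_height_model {D : DivR X} {g : GFun π} (hg : IsGreen D g) (x : X) :
    ∃ (U : X.Opens) (φ : RatR X) (θ : An π → ℝ), IsAffineOpen U ∧ x ∈ U ∧ IsLocalEquation D φ U ∧
      ContinuousOn θ (anSet π U) ∧ (θ : GFun π) = g + logAbsR π φ := by
  obtain ⟨V, φ, hxV, hφ⟩ := exists_isLocalEquation D x
  obtain ⟨_, ⟨U, hU, rfl⟩, hxU, hUV⟩ :=
    X.isBasis_affineOpens.exists_subset_of_mem_open hxV V.isOpen
  have hφU := hφ.mono (V := U) hUV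
  obtain ⟨θ, hθ, hθg⟩ := hg.2 U φ ⟨x, hxU⟩ hφU
  exact ⟨U, φ, θ, hU, hxU, hφU, hθ, hθg⟩

variable [IsProper π]

/-- The logarithm of the absolute value of an invertible function vanishes at the points whose
reduction lies in its domain. -/
theorem exists_logAbs_unit (x : X) (u : (X.functionField)ˣ) (hu : u ∈ stalkUnits X x) :
    ∃ (V : X.Opens) (θ : An π → ℝ), x ∈ V ∧ ContinuousOn θ (anSet π V) ∧
      (θ : GFun π) = logAbs π (Additive.ofMul u) ∧ ∀ ξ : An π, ξ.reduction = x → θ ξ = 0 := by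
  obtain ⟨s, rfl⟩ := hu
  obtain ⟨W, hxW, a, ha⟩ := X.presheaf.exists_germ_eq (s : X.presheaf.stalk x)
  have hxV : x ∈ X.basicOpen a := by
    rw [Scheme.mem_basicOpen X a x hxW, ha]
    exact s.isUnit
  have hunit := X.toRingedSpace.isUnit_res_basicOpen a
  obtain ⟨b, hb⟩ : ∃ b : Γ(X, X.basicOpen a),
      X.presheaf.map (homOfLE (X.basicOpen_le a)).op a * b = 1 := hunit.exists_right_inv
  refine ⟨X.basicOpen a, fun ξ => Real.log (evalAbs a ξ), hxV, ?_, ?_, fun ξ hξ => ?_⟩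
  · refine ContinuousOn.log ((continuousOn_evalAbs a).mono fun ξ hξ => X.basicOpen_le a hξ) ?_
    exact fun ξ hξ => (evalAbs_ne_zero_iff a ξ).mpr hξ
  · refine Filter.Germ.coe_eq.mpr ?_
    filter_upwards [(mem_genericFilter π (anSet π W)).mpr ⟨W, ⟨x, hxW⟩, le_rfl⟩] with ξ hξ
    have hs : algebraMap (X.presheaf.stalk x) X.functionField (X.presheaf.germ W x hxW a) =
        algebraMap (X.presheaf.stalk x) X.functionField (s : X.presheaf.stalk x) := by rw [ha]
    exact congrArg Real.log (absFun_germ hxW a hs ξ hξ).symm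
  · have hred : ξ.reduction ∈ X.basicOpen a := by rwa [hξ]
    have hpt := ξ.pt_mem_of_reduction_mem hred
    have h1 := (mem_unitDomain_of_reduction ξ hred).2 (X.presheaf.map (homOfLE (X.basicOpen_le a)).op a)
    have h2 := (mem_unitDomain_of_reduction ξ hred).2 b
    have h3 : evalAbs (X.presheaf.map (homOfLE (X.basicOpen_le a)).op a) ξ * evalAbs b ξ = 1 := by
      rw [← evalAbs_mul, hb, evalAbs_of_mem _ ξ hpt, map_one, map_one]
    rw [evalAbs_res _ _ ξ hpt] at h1 h3
    have h4 := evalAbs_nonneg a ξ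
    -- Both `a` and its inverse are regular at the reduction point, so both have absolute value at
    -- most one.
    have h5 : evalAbs a ξ = 1 := le_antisymm h1 (by nlinarith [mul_le_of_le_one_right h4 h2])
    exact (congrArg Real.log h5).trans Real.log_one

theorem exists_logAbsR_unit (x : X) (α : RatR X) (hα : mapR (localDiv X x) α = 0) :
    ∃ (V : X.Opens) (θ : An π → ℝ), x ∈ V ∧ ContinuousOn θ (anSet π V) ∧
      (θ : GFun π) = logAbsR π α ∧ ∀ ξ : An π, ξ.reduction = x → θ ξ = 0 := by
  have h := mem_span_of_mapR_eq_zero (localDiv X x) (QuotientGroup.mk'_surjective _) α hα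
  clear hα
  induction h using Submodule.span_induction with
  | mem w hw =>
    obtain ⟨u, hu, rfl⟩ := hw
    rw [logAbsR_tmul, one_smul]
    exact exists_logAbs_unit x u ((QuotientGroup.eq_one_iff u).mp hu)
  | zero => exact ⟨⊤, fun _ => 0, trivial, continuousOn_const, by rw [map_zero]; rfl, fun _ _ => rfl⟩
  | add a b _ _ ha hb =>
    obtain ⟨V, θ, hV, hθ, hθ', h0⟩ := ha
    obtain ⟨W, η, hW, hη, hη', h0'⟩ := hb
    refine ⟨V ⊓ W, θ + η, ⟨hV, hW⟩, (hθ.mono fun ξ hξ => hξ.1).add (hη.mono fun ξ hξ => hξ.2), ?_,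
      fun ξ hξ => ?_⟩
    · rw [map_add, ← hθ', ← hη']; rfl
    · rw [Pi.add_apply, h0 ξ hξ, h0' ξ hξ, add_zero]
  | smul c a _ ha =>
    obtain ⟨V, θ, hV, hθ, hθ', h0⟩ := ha
    refine ⟨V, c • θ, hV, hθ.const_smul c, ?_, fun ξ hξ => ?_⟩
    · rw [map_smul, ← hθ']; rfl
    · rw [Pi.smul_apply, h0 ξ hξ, smul_zero]

/-- The difference of two local equations is a real combination of units at the reduction point, so
its logarithm extends continuously with value zero at `ξ`. By density it is the difference of the
two extensions. -/
theorem IsHeightValue.unique {D : DivR X} {g : GFun π} {ξ : An π} {t t' : ℝ}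
    (h : IsHeightValue D g ξ t) (h' : IsHeightValue D g ξ t') : t = t' := by
  obtain ⟨U, φ, θ, hU, hφ, hθ, hθg, rfl⟩ := h
  obtain ⟨U', φ', θ', hU', hφ', hθ', hθg', rfl⟩ := h'
  obtain ⟨V, η, hV, hη, hηg, h0⟩ := exists_logAbsR_unit (π := π) ξ.reduction (φ - φ') (by
    rw [map_sub, ← hφ _ hU, ← hφ' _ hU', sub_self])
  have hmem : ξ ∈ anSet π (U ⊓ U' ⊓ V) :=
    ξ.pt_mem_of_reduction_mem (U := U ⊓ U' ⊓ V) ⟨⟨hU, hU'⟩, hV⟩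
  have key := eqOn_of_germ_eq (π := π) (U := U ⊓ U' ⊓ V) (θ := θ - θ') (θ' := η)
    ((hθ.mono fun ζ hζ => hζ.1.1).sub (hθ'.mono fun ζ hζ => hζ.1.2))
    (hη.mono fun ζ hζ => hζ.2) (by
      rw [hηg, map_sub, ← add_sub_add_left_eq_sub _ _ g, ← hθg, ← hθg']; rfl) hmem
  rw [h0 ξ rfl, Pi.sub_apply] at key
  exact sub_eq_zero.mp key

theorem IsHeightValue.height_eq {D : DivR X} {g : GFun π} {ξ : An π} {t : ℝ}
    (h : IsHeightValue D g ξ t) : height D g ξ = t :=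
  (Classical.epsilon_spec (p := IsHeightValue D g ξ) ⟨t, h⟩).unique h

/-- The height attached to a Green function is a bounded function on `X^an`. -/
theorem exists_height_bound {D : DivR X} {g : GFun π} (hg : IsGreen D g) :
    ∃ C : ℝ, ∀ ξ : An π, |height D g ξ| ≤ C := by
  have := compactSpace_of_isProper π
  choose U φ θ hU hxU hφ hθ hθg using exists_height_model hg
  -- The extension `θ x` may be unbounded on `U^an`, but only its values on the compact unit domain
  -- matter for points reducing into `U x`.
  have hbd (x : X) : ∃ C, ∀ ξ ∈ unitDomain π (U x), |θ x ξ| ≤ C :=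
    (isCompact_unitDomain (hU x)).exists_bound_of_continuousOn ((hθ x).mono fun ξ hξ => hξ.1)
  choose C hC using hbd
  obtain ⟨t, ht⟩ := isCompact_univ.elim_finite_subcover (fun x => (U x : Set X))
    (fun x => (U x).isOpen) fun x _ => Set.mem_iUnion.mpr ⟨x, hxU x⟩
  refine ⟨∑ x ∈ t, |C x|, fun ξ => ?_⟩
  obtain ⟨x, hx, hx'⟩ := Set.mem_iUnion₂.mp (ht (Set.mem_univ ξ.reduction))
  have h1 : IsHeightValue D g ξ (θ x ξ) := ⟨U x, φ x, θ x, hx', hφ x, hθ x, hθg x, rfl⟩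
  rw [h1.height_eq]
  exact ((hC x ξ (mem_unitDomain_of_reduction ξ hx')).trans (le_abs_self _)).trans
    (Finset.single_le_sum (f := fun x => |C x|) (fun y _ => abs_nonneg _) hx)

variable {f : X ⟶ X} [IsDominant f] {hf : f ≫ π = π} {D : DivR X} {d : ℝ} {φ : RatR X} {g : GFun π}

theorem height_anMap (hd : d ≠ 0) (hD : pullbackDivR f D = d • D + principalR X φ)
    (hg : IsCanonicalGreen f hf D d φ g) (ξ : An π) :
    height D g (anMap f hf ξ) = d * height D g ξ := by
  obtain ⟨U, ψ, θ, -, hU, hψ, hθ, hθg⟩ := exists_height_model hg.1 (anMap f hf ξ).reduction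
  have h1 : IsHeightValue D g (anMap f hf ξ) (θ (anMap f hf ξ)) :=
    ⟨U, ψ, θ, hU, hψ, hθ, hθg, rfl⟩
  have h2 : IsHeightValue D g ξ (d⁻¹ * θ (anMap f hf ξ)) := by
    -- Solving `f^*D = dD + (φ)` for `D` turns the pullback of `ψ` into a local equation of `D` at
    -- the reduction of `ξ`; the same substitution in `(f^an)^*g = dg - log|φ|` gives the extension.
    refine ⟨f ⁻¹ᵁ U, d⁻¹ • (pullbackRatR f ψ - φ), d⁻¹ • (θ ∘ anMap f hf), ?_, ?_, ?_, ?_, rfl⟩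
    · rw [reduction_anMap] at hU
      exact hU
    · intro x hx
      have h3 := hψ.pullback f x hx
      rw [hD, map_add, map_smul, isLocalEquation_principalR φ ⊤ x trivial] at h3
      rw [map_smul, map_sub, ← h3, add_sub_cancel_right, smul_smul, inv_mul_cancel₀ hd, one_smul]
    · exact (hθ.comp (continuous_anMap f hf).continuousOn fun ζ hζ => hζ).const_smul d⁻¹
    · have h3 := congrArg (pullbackGFun f hf) hθg
      rw [pullbackGFun_coe, pullbackGFun_add, hg.2, pullbackGFun_logAbsR] at h3
      have h4 : ((d⁻¹ • (θ ∘ anMap f hf) : An π → ℝ) : GFun π) =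
          d⁻¹ • ((θ ∘ anMap f hf : An π → ℝ) : GFun π) := rfl
      rw [h4, h3, map_smul, map_sub, smul_add, smul_sub, smul_sub, smul_smul, inv_mul_cancel₀ hd,
        one_smul]
      abel
  rw [h1.height_eq, h2.height_eq, mul_inv_cancel_left₀ hd]

/-- The height attached to the canonical Green function vanishes: it is bounded and is multiplied by
`d > 1` under `f`. -/
theorem height_eq_zero (hd : 1 < d) (hD : pullbackDivR f D = d • D + principalR X φ)
    (hg : IsCanonicalGreen f hf D d φ g) (ξ : An π) : height D g ξ = 0 := by
  obtain ⟨C, hC⟩ := exists_height_bound hg.1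
  have hiter (n : ℕ) : height D g ((anMap f hf)^[n] ξ) = d ^ n * height D g ξ := by
    induction n with
    | zero => simp
    | succ n ih =>
      rw [Function.iterate_succ_apply', height_anMap (by positivity) hD hg, ih, pow_succ]
      ring
  by_contra hne
  have hpos : 0 < |height D g ξ| := abs_pos.mpr hne
  obtain ⟨n, hn⟩ := pow_unbounded_of_one_lt (C / |height D g ξ|) hd
  have h1 := hC ((anMap f hf)^[n] ξ)
  rw [hiter, abs_mul, abs_of_pos (pow_pos (zero_lt_one.trans hd) n)] at h1
  rw [div_lt_iff₀ hpos] at hn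
  linarith

end Height

end

end TrivArakelov

namespace TrivArakelov

noncomputable section

/-! ### The generic point -/

section GenericValue

variable {K : Type u} [Field K] {X : Scheme.{u}} {π : X ⟶ Spec (.of K)}

theorem trivialPoint_abv {x : X} {a : X.residueField x} (ha : a ≠ 0) :
    (trivialPoint π x).abv a = 1 := by
  classical
  exact AbsoluteValue.trivial_apply (R := X.residueField x) ha

theorem anMap_trivialPoint (f : X ⟶ X) (hf : f ≫ π = π) (x : X) :
    anMap f hf (trivialPoint π x) = trivialPoint π (f x) := by
  have h : ∀ a : X.residueField (f x),
      (trivialPoint π x).abv (f.residueFieldMap x a) = (trivialPoint π (f x)).abv a := by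
    intro a
    by_cases ha : a = 0
    · rw [ha, map_zero]; exact (map_zero _).trans (map_zero _).symm
    · have h1 : f.residueFieldMap x a ≠ 0 := (map_ne_zero (f.residueFieldMap x).hom).mpr ha
      exact (trivialPoint_abv h1).trans (trivialPoint_abv (π := π) ha).symm
  exact An.ext rfl (heq_of_eq (AbsoluteValue.ext h))

variable [IsIntegral X]

theorem anMap_genericAn (f : X ⟶ X) [IsDominant f] (hf : f ≫ π = π) :
    anMap f hf (genericAn π) = genericAn π := by
  rw [genericAn, anMap_trivialPoint, map_genericPoint f]

theorem valueGeneric_add (g h : GFun π) :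
    valueGeneric (g + h) = valueGeneric g + valueGeneric h := by
  induction g using Filter.Germ.inductionOn
  induction h using Filter.Germ.inductionOn
  rfl

theorem valueGeneric_smul (c : ℝ) (g : GFun π) : valueGeneric (c • g) = c * valueGeneric g := by
  induction g using Filter.Germ.inductionOn
  rfl

theorem valueGeneric_pullbackGFun (f : X ⟶ X) [IsDominant f] (hf : f ≫ π = π) (g : GFun π) :
    valueGeneric (pullbackGFun f hf g) = valueGeneric g := by
  induction g using Filter.Germ.inductionOn with
  | _ θ => exact congrArg θ (anMap_genericAn f hf)

/-- A non-zero rational function is a unit at the generic point, where the trivial absolute value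
makes it one. -/
theorem valueGeneric_logAbsR (φ : RatR X) : valueGeneric (logAbsR π φ) = 0 := by
  induction φ using TensorProduct.induction_on with
  | zero => rw [map_zero]; rfl
  | tmul r u =>
    rw [logAbsR_tmul, valueGeneric_smul]
    obtain ⟨t, ht, hS⟩ := eventually_isUnit π u.toMul
    have hη : genericAn π ∈ An.pt ⁻¹' t := mem_of_mem_nhds (x := genericPoint X) ht
    obtain ⟨s, hs⟩ := hS hη
    have h1 : valueGeneric (logAbs π u) =
      Real.log (absFun π (u.toMul : X.functionField) (genericAn π)) := rfl
    have h2 : (genericAn π).abv (X.residue (genericAn π).pt s) = 1 :=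
      trivialPoint_abv (π := π) (x := genericPoint X)
        (s.isUnit.map (X.residue (genericAn π).pt).hom).ne_zero
    rw [h1, ← hs, absFun_algebraMap, h2, Real.log_one, mul_zero]
  | add x y hx hy => rw [map_add, valueGeneric_add, hx, hy, add_zero]

end GenericValue

/-! ### Effective adelic divisors -/

section AdelicEffective

variable {K : Type u} [Field K] {X : Scheme.{u}} [IsIntegral X] {π : X ⟶ Spec (.of K)}

/-- Continuous functions on `U^an` with compatible germs glue. -/
theorem exists_continuous_of_local [LocallyOfFiniteType π] (G : GFun π)
    (h : ∀ x : X, ∃ (U : X.Opens) (θ : An π → ℝ), x ∈ U ∧ ContinuousOn θ (anSet π U) ∧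
      (θ : GFun π) = G) : ∃ E : An π → ℝ, Continuous E ∧ (E : GFun π) = G := by
  choose U θ hxU hθ hθG using h
  have key (x : X) : Set.EqOn (fun ξ => θ ξ.pt ξ) (θ x) (anSet π (U x)) := by
    intro ξ hξ
    exact eqOn_of_germ_eq (U := U ξ.pt ⊓ U x) ((hθ ξ.pt).mono fun ζ hζ => hζ.1)
      ((hθ x).mono fun ζ hζ => hζ.2) ((hθG _).trans (hθG _).symm) ⟨hxU _, hξ⟩
  refine ⟨fun ξ => θ ξ.pt ξ, continuous_iff_continuousAt.mpr fun ξ => ?_, ?_⟩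
  · exact ((hθ ξ.pt).congr (key ξ.pt)).continuousAt ((isOpen_anSet _).mem_nhds (hxU _))
  · rw [← hθG (genericPoint X)]
    refine Filter.Germ.coe_eq.mpr ?_
    filter_upwards [(mem_genericFilter π _).mpr ⟨U (genericPoint X), ⟨_, hxU _⟩, le_rfl⟩] with ξ hξ
    exact key _ hξ

theorem continuousOn_absFun (φ : X.functionField) (U : X.Opens)
    (h : ∀ y ∈ U, φ ∈ (algebraMap (X.presheaf.stalk y) X.functionField).range) :
    ContinuousOn (absFun π φ) (anSet π U) := by
  intro ξ hξ
  obtain ⟨s, hs⟩ := h ξ.pt hξ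
  obtain ⟨W, hW, a, ha⟩ := X.presheaf.exists_germ_eq s
  have hφ : algebraMap (X.presheaf.stalk ξ.pt) X.functionField (X.presheaf.germ W ξ.pt hW a) = φ := by
    rw [ha, hs]
  have h1 : ContinuousAt (evalAbs a : An π → ℝ) ξ :=
    (continuousOn_evalAbs a).continuousAt ((isOpen_anSet W).mem_nhds hW)
  refine (h1.congr ?_).continuousWithinAt
  filter_upwards [(isOpen_anSet W).mem_nhds hW] with ζ hζ
  exact (absFun_germ hW a hφ ζ hζ).symm

/-- A divisor `D` has near `x` a local equation `χ` for which `|χ|` extends to a continuous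
function. -/
def HasRegularEquation (π : X ⟶ Spec (.of K)) (D : DivR X) (x : X) : Prop :=
  ∃ (U : X.Opens) (χ : RatR X) (θ : An π → ℝ), x ∈ U ∧ IsLocalEquation D χ U ∧
    ContinuousOn θ (anSet π U) ∧ (θ : GFun π) = (logAbsR π χ).map Real.exp

theorem HasRegularEquation.add {D E : DivR X} {x : X} (hD : HasRegularEquation π D x)
    (hE : HasRegularEquation π E x) : HasRegularEquation π (D + E) x := by
  obtain ⟨U, χ, θ, hU, hχ, hθ, hθχ⟩ := hD
  obtain ⟨V, ψ, η, hV, hψ, hη, hηψ⟩ := hE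
  refine ⟨U ⊓ V, χ + ψ, θ * η, ⟨hU, hV⟩, (hχ.mono inf_le_left).add (hψ.mono inf_le_right),
    (hθ.mono fun ζ hζ => hζ.1).mul (hη.mono fun ζ hζ => hζ.2), ?_⟩
  rw [map_add]
  generalize logAbsR π χ = A at *
  generalize logAbsR π ψ = B at *
  induction A using Filter.Germ.inductionOn with
  | _ a =>
  induction B using Filter.Germ.inductionOn with
  | _ b =>
  refine Filter.Germ.coe_eq.mpr ?_
  filter_upwards [Filter.Germ.coe_eq.mp hθχ, Filter.Germ.coe_eq.mp hηψ] with ξ h1 h2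
  change θ ξ * η ξ = Real.exp (a ξ + b ξ)
  rw [Real.exp_add, h1, h2]
  rfl

theorem hasRegularEquation_zero (x : X) : HasRegularEquation π 0 x := by
  refine ⟨⊤, 0, fun _ => 1, trivial, fun y _ => by rw [map_zero, map_zero], continuousOn_const, ?_⟩
  rw [map_zero]
  exact Filter.Germ.coe_eq.mpr (Filter.Eventually.of_forall fun ξ => Real.exp_zero.symm)

theorem Div.IsEffective.hasRegularEquation {E : Div X} (hE : E.IsEffective) {a : ℝ} (ha : 0 ≤ a)
    (x : X) : HasRegularEquation π (a • E.toR) x := by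
  obtain ⟨U, hxU, φ, hφ⟩ := E.2 x
  refine ⟨U, a • (1 ⊗ₜ[ℤ] Additive.ofMul φ), fun ξ => absFun π φ ξ ^ a, hxU,
    (isLocalEquation_toR hφ).smul a, ?_, ?_⟩
  -- A non-negative exponent keeps the power continuous also at the zeros of `φ`.
  · exact (continuousOn_absFun _ U fun y hy => hE y φ (hφ y hy)).rpow_const fun _ _ => Or.inr ha
  · rw [map_smul, logAbsR_tmul, one_smul]
    refine Filter.Germ.coe_eq.mpr ?_
    filter_upwards [eventually_isUnit π φ] with ξ hξ
    obtain ⟨s, hs⟩ := hξ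
    have hpos : 0 < absFun π (φ : X.functionField) ξ := by
      rw [← hs, absFun_algebraMap]
      exact ξ.abv.pos (s.isUnit.map (X.residue ξ.pt).hom).ne_zero
    rw [Real.rpow_def_of_pos hpos, mul_comm]
    rfl

theorem IsEffective.hasRegularEquation {D : DivR X} (hD : IsEffective D) (x : X) :
    HasRegularEquation π D x := by
  obtain ⟨r, E, a, hE, ha, rfl⟩ := hD
  exact Finset.sum_induction _ (fun D => HasRegularEquation π D x) (fun _ _ h h' => h.add h')
    (hasRegularEquation_zero x) fun i _ => (hE i).hasRegularEquation (ha i).le x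

/-- With `χ` a local equation of `D + (s)` for which `|χ|` extends continuously, `χ - s` (in
additive notation) is one of `D`. Then `e^{-(g - log|s|)}` is `|χ|` times the exponential of minus
the extension of `g + log|χ - s|`. Such local extensions glue by density. -/
theorem exists_continuous_exp_neg [LocallyOfFiniteType π] {D : DivR X} {g : GFun π}
    (hg : IsGreen D g) {s : RatR X} (hs : IsEffective (D + principalR X s)) :
    ∃ E : An π → ℝ, Continuous E ∧
      (E : GFun π) = (g - logAbsR π s).map fun t => Real.exp (-t) := by
  refine exists_continuous_of_local _ fun x => ?_
  obtain ⟨U, χ, η, hU, hχ, hη, hηχ⟩ := hs.hasRegularEquation (π := π) x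
  have hψ : IsLocalEquation D (χ - s) U := fun y hy => by
    have h1 := hχ y hy
    rw [map_add, isLocalEquation_principalR s U y hy] at h1
    rw [map_sub, ← h1, add_sub_cancel_right]
  obtain ⟨θ, hθ, hθg⟩ := hg.2 U (χ - s) ⟨x, hU⟩ hψ
  refine ⟨U, fun ξ => Real.exp (-θ ξ) * η ξ, hU, hθ.neg.rexp.mul hη, ?_⟩
  rw [map_sub] at hθg
  generalize logAbsR π χ = A at *
  generalize logAbsR π s = B at *
  induction A using Filter.Germ.inductionOn with
  | _ a =>
  induction B using Filter.Germ.inductionOn with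
  | _ b =>
  induction g using Filter.Germ.inductionOn with
  | _ γ =>
  refine Filter.Germ.coe_eq.mpr ?_
  filter_upwards [Filter.Germ.coe_eq.mp hθg, Filter.Germ.coe_eq.mp hηχ] with ξ h1 h2
  change Real.exp (-θ ξ) * η ξ = Real.exp (-(γ ξ - b ξ))
  change θ ξ = γ ξ + (a ξ - b ξ) at h1
  change η ξ = Real.exp (a ξ) at h2
  rw [h1, h2, ← Real.exp_add]
  congr 1
  ring

/-- `D + (ψ)` is effective, and `e^{-(g - log |ψ|)}` extends to a continuous function on `X^an` with
values in `[0, e^C]`. -/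
def IsEffectiveUpTo (D : DivR X) (g : GFun π) (ψ : RatR X) (C : ℝ) : Prop :=
  IsEffective (D + principalR X ψ) ∧ ∃ E : An π → ℝ, Continuous E ∧
    ((E : GFun π) = (g - logAbsR π ψ).map fun t => Real.exp (-t)) ∧
    ∀ ξ, 0 ≤ E ξ ∧ E ξ ≤ Real.exp C

theorem exists_isEffectiveUpTo [IsProper π] {D : DivR X} {g : GFun π} (hg : IsGreen D g)
    {s : RatR X} (hs : IsEffective (D + principalR X s)) : ∃ C, IsEffectiveUpTo D g s C := by
  obtain ⟨E, hE, hEg⟩ := exists_continuous_exp_neg hg hs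
  obtain ⟨C, hC⟩ := isCompact_univ.exists_bound_of_continuousOn hE.continuousOn
  -- Passing to `|E|` gives non-negativity everywhere without changing the germ, which is that of a
  -- positive function. The bound `C` is weakened to `e^C` by `C + 1 ≤ e^C`.
  refine ⟨C, hs, fun ξ => |E ξ|, hE.abs, ?_, fun ξ => ⟨abs_nonneg _, ?_⟩⟩
  · generalize g - logAbsR π s = A at *
    induction A using Filter.Germ.inductionOn with
    | _ a =>
    refine Filter.Germ.coe_eq.mpr ?_
    filter_upwards [Filter.Germ.coe_eq.mp hEg] with ξ h
    rw [h]
    exact abs_of_pos (Real.exp_pos _)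
  · have h1 := hC ξ trivial
    rw [Real.norm_eq_abs] at h1
    linarith [Real.add_one_le_exp C]

/-- Pull back by `f` and divide by `d`: `d⁻¹ f^*(D + (ψ)) = D + (d⁻¹(f^*ψ + φ))`, and likewise for
`g - log|ψ|`. On exponentials this is composition with `f^an` followed by the power `d⁻¹`, so the
bound `e^C` becomes `e^{C/d}`. -/
theorem IsEffectiveUpTo.step {f : X ⟶ X} [IsDominant f] {hf : f ≫ π = π} {D : DivR X} {d : ℝ}
    {φ : RatR X} {g : GFun π} (hd : 0 < d) (hD : pullbackDivR f D = d • D + principalR X φ)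
    (hg : pullbackGFun f hf g = d • g - logAbsR π φ) {ψ : RatR X} {C : ℝ}
    (h : IsEffectiveUpTo D g ψ C) :
    IsEffectiveUpTo D g (d⁻¹ • (pullbackRatR f ψ + φ)) (C * d⁻¹) := by
  obtain ⟨h1, E, hE, hEg, hEC⟩ := h
  constructor
  · have h2 := (h1.pullback f).smul (inv_pos.mpr hd)
    rw [map_add, hD, pullbackDivR_principalR, smul_add, smul_add, smul_smul,
      inv_mul_cancel₀ hd.ne', one_smul] at h2
    rw [map_smul, map_add, smul_add, add_comm (d⁻¹ • (principalR X) ((pullbackRatR f) ψ)),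
      ← add_assoc]
    exact h2
  · have h3 : g - logAbsR π (d⁻¹ • (pullbackRatR f ψ + φ)) =
        d⁻¹ • pullbackGFun f hf (g - logAbsR π ψ) := by
      rw [pullbackGFun_sub, hg, pullbackGFun_logAbsR, map_smul, map_add, smul_sub, smul_sub,
        smul_add, smul_smul, inv_mul_cancel₀ hd.ne', one_smul]
      abel
    rw [h3]
    refine ⟨fun ξ => E (anMap f hf ξ) ^ d⁻¹, (hE.comp (continuous_anMap f hf)).rpow_const
      fun ξ => Or.inr (inv_nonneg.mpr hd.le), ?_, fun ξ => ⟨Real.rpow_nonneg (hEC _).1 _, ?_⟩⟩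
    · generalize g - logAbsR π ψ = A at *
      induction A using Filter.Germ.inductionOn with
      | _ a =>
      refine Filter.Germ.coe_eq.mpr ?_
      filter_upwards [(tendsto_anMap f hf).eventually (Filter.Germ.coe_eq.mp hEg)] with ξ h4
      rw [h4]
      change Real.exp (-a (anMap f hf ξ)) ^ d⁻¹ = Real.exp (-(d⁻¹ * a (anMap f hf ξ)))
      rw [← Real.exp_mul]
      congr 1
      ring
    · rw [Real.exp_mul]
      exact Real.rpow_le_rpow (hEC _).1 (hEC _).2 (inv_nonneg.mpr hd.le)

theorem IsEffectiveUpTo.isAdelicEffective {D : DivR X} {g : GFun π} {ψ : RatR X} {C ε : ℝ}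
    (h : IsEffectiveUpTo D g ψ C) (hC : C ≤ ε) :
    IsAdelicEffective (D + principalR X ψ)
      (g + ((fun _ => ε : An π → ℝ) : GFun π) - logAbsR π ψ) := by
  obtain ⟨h1, E, hE, hEg, hEC⟩ := h
  -- Adding `ε` to the Green function multiplies the exponential by `e^{-ε}`, which brings the bound
  -- `e^C` down to at most one.
  refine ⟨h1, fun ξ => ⟨Real.exp (-ε) * E ξ, mul_nonneg (Real.exp_pos _).le (hEC ξ).1⟩,
    (continuous_const.mul hE).subtype_mk _, ?_, fun ξ => ?_⟩
  · generalize logAbsR π ψ = B at *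
    induction B using Filter.Germ.inductionOn with
    | _ b =>
    induction g using Filter.Germ.inductionOn with
    | _ γ =>
    refine Filter.Germ.coe_eq.mpr ?_
    filter_upwards [Filter.Germ.coe_eq.mp hEg] with ξ h2
    change Real.exp (-ε) * E ξ = Real.exp (-(γ ξ + ε - b ξ))
    change E ξ = Real.exp (-(γ ξ - b ξ)) at h2
    rw [h2, ← Real.exp_add]
    congr 1
    ring
  · have h3 : Real.exp (-ε) * E ξ ≤ 1 := by
      calc Real.exp (-ε) * E ξ ≤ Real.exp (-ε) * Real.exp C := by
            gcongr; exact (hEC ξ).2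
        _ = Real.exp (C - ε) := by rw [← Real.exp_add]; congr 1; ring
        _ ≤ 1 := Real.exp_le_one_iff.mpr (by linarith)
    rw [EReal.neg_nonneg, ← ENNReal.log_one]
    refine ENNReal.log_monotone ?_
    exact ENNReal.coe_le_one_iff.mpr h3

/-- After `n` steps the defect is `C d⁻ⁿ`, which eventually drops below `ε`. -/
theorem exists_isAdelicEffective [IsProper π] {f : X ⟶ X} [IsDominant f] {hf : f ≫ π = π}
    {D : DivR X} {d : ℝ} {φ : RatR X} {g : GFun π} (hd : 1 < d)
    (hD : pullbackDivR f D = d • D + principalR X φ) (hg : IsCanonicalGreen f hf D d φ g)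
    {s : RatR X} (hs : IsEffective (D + principalR X s)) {ε : ℝ} (hε : 0 < ε) :
    ∃ ψ : RatR X, IsAdelicEffective (D + principalR X ψ)
      (g + ((fun _ => ε : An π → ℝ) : GFun π) - logAbsR π ψ) := by
  obtain ⟨C, hC⟩ := exists_isEffectiveUpTo hg.1 hs
  have hd0 : 0 < d := zero_lt_one.trans hd
  have hiter (n : ℕ) : ∃ ψ, IsEffectiveUpTo D g ψ (C * d⁻¹ ^ n) := by
    induction n with
    | zero => exact ⟨s, by simpa using hC⟩
    | succ n ih =>
      obtain ⟨ψ, hψ⟩ := ih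
      have h := hψ.step hd0 hD hg.2
      rw [mul_assoc, ← pow_succ] at h
      exact ⟨_, h⟩
  have hlim : Filter.Tendsto (fun n : ℕ => C * d⁻¹ ^ n) Filter.atTop (𝓝 0) := by
    simpa using (tendsto_pow_atTop_nhds_zero_of_lt_one (inv_nonneg.mpr hd0.le)
      (inv_lt_one_of_one_lt₀ hd)).const_mul C
  obtain ⟨n, hn⟩ := (hlim.eventually (gt_mem_nhds hε)).exists
  obtain ⟨ψ, hψ⟩ := hiter n
  exact ⟨ψ, hψ.isAdelicEffective hn.le⟩

end AdelicEffective

end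

end TrivArakelov

theorem mainTheorem10 {K : Type u} [Field K] {X : Scheme.{u}} [AlgebraicGeometry.IsIntegral X]
    (π : X ⟶ Spec (.of K)) [IsProjectiveOver π]
    (f : X ⟶ X) [AlgebraicGeometry.Surjective f] (hf : f ≫ π = π)
    (D : DivR X) (d : ℝ) (hd : 1 < d) (φ : RatR X)
    (hD : pullbackDivR f D = d • D + principalR X φ)
    (g : GFun π) (hg : IsCanonicalGreen f hf D d φ g) :
    (∀ ξ : An π,
      height D g (anMap f hf ξ) = d * height D g ξ) ∧
    (∀ (ξ : An π) (n m : ℕ), n < m →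
      (anMap f hf)^[n] ξ = (anMap f hf)^[m] ξ →
        height D g ξ = 0) ∧
    (height D g (genericAn π) = 0 ∧
      valueGeneric g = 0) ∧
    (IsSemiample D → ∀ ξ : An π, 0 ≤ height D g ξ) ∧
    ((∃ s : RatR X, IsEffective (D + principalR X s)) →
      ∀ ε : ℝ, 0 < ε → ∃ ψ : RatR X,
        IsAdelicEffective (D + principalR X ψ)
          (g + ((fun _ => ε : An π → ℝ) : GFun π) -
            logAbsR π ψ)) := by
  refine ⟨height_anMap (zero_lt_one.trans hd).ne' hD hg, fun ξ _ _ _ _ => height_eq_zero hd hD hg ξ,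
    ⟨height_eq_zero hd hD hg _, ?_⟩, fun _ ξ => (height_eq_zero hd hD hg ξ).ge,
    fun ⟨s, hs⟩ ε hε => exists_isAdelicEffective hd hD hg hs hε⟩
  -- Evaluated at the fixed point `η₀`, the functional equation reads `g(η₀) = d g(η₀)`.
  have h := congrArg valueGeneric hg.2
  rw [valueGeneric_pullbackGFun, sub_eq_add_neg, ← map_neg, valueGeneric_add, valueGeneric_smul,
    valueGeneric_logAbsR, add_zero] at h
  have h1 : (d - 1) * valueGeneric g = 0 := by linarith
  exact (mul_eq_zero.mp h1).resolve_left (by linarith)
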